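/- Let $\gamma$ be Euler's constant, $B_m$ the Bernoulli numbers, $\zeta$ the Riemann zeta function, $\log$ the principal branch of the logarithm, and let $A>0$ be the Glaisher–Kinkelin constant, defined by the (convergent) limit $$\log A=\lim_{n\to\infty}\Big\{\sum_{k=1}^{n}k\log k-\Big(\frac{n^2}{2}+\frac n2+\frac1{12}\Big)\log n+\frac{n^2}{4}\Big\}.$$ The series $\sum_{n\ge1}\frac{\log n}{e^{ny}-1}$ converges absolutely for $\operatorname{Re}y>0$, and as $y\to0$ in $|\arg y|<\pi/2$ it has the complete asymptotic expansion $$\sum_{n=1}^{\infty}\frac{\log n}{e^{ny}-1}\sim\frac{\log^2 y}{2y}+\frac1y\Big(\frac{\pi^2}{12}-\frac{\gamma^2}{2}\Big)-\frac14\log(2\pi)+\frac{y}{12}\Big(\log A-\frac1{12}\Big)+\sum_{k=2}^{\infty}\frac{B_{2k}\,y^{2k-1}}{k}\Big\{\frac{B_{2k}}{2(2k)!}\Big(\gamma-\sum_{j=1}^{2k-1}\frac1j+\log(2\pi)\Big)+\frac{(-1)^k\zeta'(2k)}{(2\pi)^{2k}}\Big\}.$$ Here $\sim$ means: for every $\theta<\pi/2$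 and every integer $N\ge1$, the difference between the left-hand side and the right-hand side with the sum over $k$ restricted to $2\le k\le N$ is $O(|y|^{2N+1})$ as $y\to0$ with $y\neq 0$, $|\arg y|\le\theta$, the implied constant depending only on $\theta$ and $N$. -/

import Mathlib

open Filter Topology Asymptotics

noncomputable section

/-- The sequence
`∑_{k=1}^n k log k - (n²/2 + n/2 + 1/12) log n + n²/4`, whose limit is the logarithm of the
Glaisher–Kinkelin constant. -/
def glaisherSeq (n : ℕ) : ℝ :=
  (∑ k ∈ Finset.Icc 1 n, (k : ℝ) * Real.log k)
    - ((n : ℝ) ^ 2 / 2 + (n : ℝ) / 2 + 1 / 12) * Real.log n + (n : ℝ) ^ 2 / 4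

/-- The Glaisher–Kinkelin constant `A`, defined by `log A = lim_{n → ∞} glaisherSeq n`. -/
def glaisherKinkelin : ℝ :=
  Real.exp (limUnder atTop glaisherSeq)

/-- The closed sector `|arg y| ≤ θ` with its vertex `0` removed. -/
def puncturedSector (θ : ℝ) : Set ℂ :=
  {y : ℂ | y ≠ 0 ∧ |y.arg| ≤ θ}

/-- The `n`-th term `log n / (e^{ny} - 1)` of the Lambert series of the logarithm. -/
def lambertLogTerm (y : ℂ) (n : ℕ) : ℂ :=
  (Real.log n : ℂ) / (Complex.exp (n * y) - 1)

/-- The Lambert series `∑_{n ≥ 1} log n / (e^{ny} - 1)`. -/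
def lambertLog (y : ℂ) : ℂ :=
  ∑' n : ℕ, lambertLogTerm y (n + 1)

/-- The coefficient of `y^{2k-1}`, for `k ≥ 2`, in the expansion of `lambertLog`. -/
def lambertLogCoeff (k : ℕ) : ℂ :=
  (bernoulli (2 * k) : ℂ) / k *
    ((bernoulli (2 * k) : ℂ) / (2 * ((2 * k).factorial : ℂ)) *
        ((Real.eulerMascheroniConstant : ℂ) - (∑ j ∈ Finset.Icc 1 (2 * k - 1), 1 / (j : ℂ))
          + (Real.log (2 * Real.pi) : ℂ))
      + (-1) ^ k * deriv riemannZeta (2 * k) / (2 * (Real.pi : ℂ)) ^ (2 * k))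

/-- The expansion of `lambertLog` as `y → 0`, truncated after the term in `y^{2N-1}`. -/
def lambertLogPartial (N : ℕ) (y : ℂ) : ℂ :=
  1 / (2 * y) * Complex.log y ^ 2
    + 1 / y * ((Real.pi : ℂ) ^ 2 / 12 - (Real.eulerMascheroniConstant : ℂ) ^ 2 / 2)
    - 1 / 4 * (Real.log (2 * Real.pi) : ℂ)
    + y / 12 * ((Real.log glaisherKinkelin : ℂ) - 1 / 12)
    + ∑ k ∈ Finset.Icc 2 N, lambertLogCoeff k * y ^ (2 * k - 1)

end

/-!
# The asymptotic expansion of the Lambert series of the logarithm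

Expanding `1 / (e^{ny} - 1)` as a geometric series and inserting the Cahen–Mellin integral for
`e^{-nmy}` turns the Lambert series into the Mellin–Barnes integral
`(2πi)⁻¹ ∫ Γ(s) ζ(s) (-ζ'(s)) y⁻ˢ ds` on the line `re s = 3` (`hasSum_lambertLogTerm`). Moving the
line to the left picks up the terms of the expansion as residues, and the integral on the line
`re s = c` is `O(|y|^{-c})`.

* The shift is legitimate, and the integral is bounded uniformly in `|arg y| ≤ θ < π/2`, because the
  integrand decays like `e^{κ|t|}` with `κ` as close to `-π/2` as desired while
  `|y⁻ˢ| ≤ |y|^{-re s} e^{θ|t|}`. For `Γ` this comes from rotating the path in Euler's integral.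
  For `ζ` any growth slower than every exponential `e^{ε|t|}` suffices: it follows from
  Euler–Maclaurin summation on the right and from the functional equation on the left, and passes
  to `ζ'` by Cauchy's estimate (`verticalExpBound_lambertMellin`).
* At the triple pole `s = 1` the expansions of `Γ`, `ζ` and `y⁻ˢ` to second order give the terms in
  `log² y / y` and `1 / y` (`exists_principalPart_one`); the second-order coefficient of `Γ` comes
  from the reflection formula.
* At `s = -j` the residue is `(-1)ʲ / j! · ζ(-j) (-ζ'(-j)) yʲ` (`lambertResidue`). It vanishes for
  even `j ≥ 2`, and for odd `j` the value of `ζ'(-j)` comes from differentiating the functional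
  equation (`lambertResidue_odd`).
* For `j = 1` the Glaisher–Kinkelin constant enters through `log A = 1/12 - ζ'(-1)`. The
  Euler–Maclaurin approximations of `(s - 1) ζ(s)` converge together with their derivatives for
  `re s > -3/2`, and at `s = -1` these derivatives are the defining sequence of `log A`, up to an
  affine map (`tendsto_glaisherSeq`).
-/

/-! ### Moving a vertical line of integration across a real pole -/

section ContourShift

open Complex MeasureTheory Set

lemma vertical_ne_zero {d : ℝ} (hd : d ≠ 0) (t : ℝ) : (d + t * I : ℂ) ≠ 0 := fun h => by
  have := congrArg re h
  simp [hd] at this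

lemma intervalIntegral_inv_vertical {d : ℝ} (hd : 0 < d) (T : ℝ) :
    ∫ t in (-T)..T, (d + t * I : ℂ)⁻¹ = 2 * Real.arctan (T / d) := by
  have harg (t : ℝ) : (d + t * I : ℂ).arg = Real.arctan (t / d) := by
    rw [Complex.arg_of_re_nonneg (by simpa using hd.le), Real.arctan_eq_arcsin]
    congr 1
    have h1 : ‖(d + t * I : ℂ)‖ = d * √(1 + (t / d) ^ 2) := by
      rw [Complex.norm_add_mul_I, show d ^ 2 + t ^ 2 = d ^ 2 * (1 + (t / d) ^ 2) by field_simp,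
        Real.sqrt_mul (sq_nonneg d), Real.sqrt_sq hd.le]
    rw [h1]
    simp
    field_simp
  have hnorm : ‖(d + T * I : ℂ)‖ = ‖(d + (-T : ℝ) * I : ℂ)‖ := by
    rw [Complex.norm_add_mul_I, Complex.norm_add_mul_I, neg_sq]
  have hder (t : ℝ) :
      HasDerivAt (fun t : ℝ => -I * Complex.log (d + t * I)) (d + t * I : ℂ)⁻¹ t := by
    have h2 : HasDerivAt (fun t : ℝ => (d + t * I : ℂ)) I t := by
      simpa using ((hasDerivAt_id t).ofReal_comp.mul_const I).const_add (d : ℂ)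
    have := (h2.clog_real (by left; simpa using hd)).const_mul (-I)
    refine this.congr_deriv ?_
    rw [div_eq_mul_inv, ← mul_assoc, neg_mul, I_mul_I, neg_neg, one_mul]
  have hcont : Continuous fun t : ℝ => (d + t * I : ℂ)⁻¹ :=
    Continuous.inv₀ (by fun_prop) (vertical_ne_zero hd.ne')
  rw [intervalIntegral.integral_eq_sub_of_hasDerivAt (fun t _ => hder t)
    (hcont.intervalIntegrable _ _)]
  simp only [Complex.log, harg, hnorm, neg_div, Real.arctan_neg]
  simp only [ofReal_neg]
  linear_combination (-2 * (Real.arctan (T / d) : ℂ)) * I_sq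

lemma tendsto_intervalIntegral_inv_vertical {d : ℝ} (hd : 0 < d) :
    Tendsto (fun T : ℝ => ∫ t in (-T)..T, (d + t * I : ℂ)⁻¹) atTop (𝓝 Real.pi) := by
  simp only [intervalIntegral_inv_vertical hd]
  have h : Tendsto (fun T : ℝ => Real.arctan (T / d)) atTop (𝓝 (Real.pi / 2)) :=
    (tendsto_nhds_of_tendsto_nhdsWithin Real.tendsto_arctan_atTop).comp
      (tendsto_id.atTop_div_const hd)
  have := ((continuous_ofReal.tendsto _).comp h).const_mul 2
  simpa [Function.comp_def, mul_div_cancel₀] using this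

lemma tendsto_intervalIntegral_inv_vertical_of_neg {d : ℝ} (hd : d < 0) :
    Tendsto (fun T : ℝ => ∫ t in (-T)..T, (d + t * I : ℂ)⁻¹) atTop (𝓝 (-Real.pi)) := by
  refine (tendsto_intervalIntegral_inv_vertical (neg_pos.2 hd)).neg.congr fun T => ?_
  have hrefl := intervalIntegral.integral_comp_neg (a := -T) (b := T)
    fun t : ℝ => (d + t * I : ℂ)⁻¹
  rw [neg_neg] at hrefl
  rw [← intervalIntegral.integral_neg, ← hrefl]
  refine intervalIntegral.integral_congr fun t _ => ?_
  rw [← inv_neg]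
  push_cast
  ring_nf

/-- The vertical integrals of `(s - p)⁻ᵏ`, `k ≥ 2`, over `[-T, T]` tend to `0`, since the integrand
has a single-valued primitive vanishing at infinity. -/
lemma tendsto_intervalIntegral_inv_pow_vertical {d : ℝ} (hd : d ≠ 0) (k : ℕ) :
    Tendsto (fun T : ℝ => ∫ t in (-T)..T, ((d + t * I : ℂ) ^ (k + 2))⁻¹) atTop (𝓝 0) := by
  have hder (t : ℝ) : HasDerivAt (fun t : ℝ => I / (k + 1) * ((d + t * I : ℂ) ^ (k + 1))⁻¹)
      ((d + t * I : ℂ) ^ (k + 2))⁻¹ t := by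
    have h2 : HasDerivAt (fun t : ℝ => (d + t * I : ℂ)) I t := by
      simpa using ((hasDerivAt_id t).ofReal_comp.mul_const I).const_add (d : ℂ)
    have h0 := vertical_ne_zero hd t
    have := ((h2.pow (k + 1)).inv (pow_ne_zero _ h0)).const_mul (I / (k + 1))
    convert! this using 1
    have hk : (k + 1 : ℂ) ≠ 0 := by exact_mod_cast k.succ_ne_zero
    simp only [Nat.add_sub_cancel, Pi.pow_apply, Nat.cast_add, Nat.cast_one]
    field_simp
    rw [I_sq]
    ring
  have hcont : Continuous fun t : ℝ => ((d + t * I : ℂ) ^ (k + 2))⁻¹ :=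
    Continuous.inv₀ (by fun_prop) fun t => pow_ne_zero _ (vertical_ne_zero hd t)
  have hF (T : ℝ) := intervalIntegral.integral_eq_sub_of_hasDerivAt (a := -T) (b := T)
    (fun t _ => hder t) (hcont.intervalIntegrable _ _)
  simp only [hF]
  have hlim (f : ℝ → ℝ) (hf : ∀ T, |f T| = |T|) :
      Tendsto (fun T : ℝ => I / (k + 1) * ((d + (f T) * I : ℂ) ^ (k + 1))⁻¹) atTop (𝓝 0) := by
    rw [← mul_zero (I / (k + 1 : ℂ))]
    refine Tendsto.const_mul _ ?_
    refine tendsto_inv₀_cobounded.comp ?_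
    rw [← tendsto_norm_atTop_iff_cobounded]
    simp only [norm_pow]
    refine (tendsto_pow_atTop k.succ_ne_zero).comp ?_
    refine tendsto_atTop_mono (fun T => ?_) tendsto_id
    calc T ≤ |T| := le_abs_self T
      _ = |(d + (f T) * I : ℂ).im| := by simp [hf]
      _ ≤ _ := Complex.abs_im_le_norm _
  simpa using (hlim id (by simp)).sub (hlim (fun T => -T) (by simp))

lemma tendsto_intervalIntegral_of_norm_le {F : ℂ → ℂ} {c₁ c₂ : ℝ} (hc : c₁ ≤ c₂) {g : ℝ → ℝ}
    (hg : Tendsto g atTop (𝓝 0)) {f : ℝ → ℝ} (hf : ∀ T, |f T| = |T|)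
    (hF : ∀ x ∈ Icc c₁ c₂, ∀ T : ℝ, 1 ≤ |T| → ‖F (x + T * I)‖ ≤ g |T|) :
    Tendsto (fun T : ℝ => ∫ x in c₁..c₂, F (x + f T * I)) atTop (𝓝 0) := by
  refine squeeze_zero_norm' (a := fun T => g T * |c₂ - c₁|) ?_ (by simpa using hg.mul_const _)
  filter_upwards [eventually_ge_atTop 1] with T hT
  have habs : |T| = T := abs_of_nonneg (by linarith)
  refine intervalIntegral.norm_integral_le_of_norm_le_const fun x hx => ?_
  rw [uIoc_of_le hc] at hx
  have := hF x ⟨hx.1.le, hx.2⟩ (f T) (by rw [hf, habs]; exact hT)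
  rwa [hf, habs] at this

/-- **Shifting a vertical line of integration across one pole.** The function `F` has on the strip
`c₁ ≤ re s ≤ c₂` the principal part `r₁ / (s - p) + r₂ / (s - p)² + r₃ / (s - p)³` at a real
point `p` and no other singularity, and it tends to zero uniformly at both ends of the strip. -/
theorem integral_vertical_sub_eq_residue {F K : ℂ → ℂ} {c₁ c₂ p : ℝ} {r₁ r₂ r₃ : ℂ}
    (h₁ : c₁ < p) (h₂ : p < c₂) {U : Set ℂ} (hU : ∀ s : ℂ, c₁ ≤ s.re → s.re ≤ c₂ → s ∈ U)
    (hK : DifferentiableOn ℂ K U)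
    (hF : ∀ s ∈ U, s ≠ p →
      F s = r₁ * (s - p)⁻¹ + r₂ * ((s - p) ^ 2)⁻¹ + r₃ * ((s - p) ^ 3)⁻¹ + K s)
    (hi₁ : Integrable fun t : ℝ => F (c₁ + t * I)) (hi₂ : Integrable fun t : ℝ => F (c₂ + t * I))
    {g : ℝ → ℝ} (hg : Tendsto g atTop (𝓝 0))
    (hgF : ∀ x ∈ Icc c₁ c₂, ∀ T : ℝ, 1 ≤ |T| → ‖F (x + T * I)‖ ≤ g |T|) :
    (∫ t : ℝ, F (c₂ + t * I)) - ∫ t : ℝ, F (c₁ + t * I) = 2 * Real.pi * r₁ := by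
  have hc : c₁ ≤ c₂ := (h₁.trans h₂).le
  have hKeq (s : ℂ) (hs : s ∈ U) (hp : s ≠ p) : K s =
      F s - (r₁ * (s - p)⁻¹ + r₂ * ((s - p) ^ 2)⁻¹ + r₃ * ((s - p) ^ 3)⁻¹) := by
    rw [hF s hs hp]; ring
  -- The horizontal sides contribute nothing in the limit.
  have hKhor (f : ℝ → ℝ) (hf : ∀ T, |f T| = |T|) :
      Tendsto (fun T : ℝ => ∫ x in c₁..c₂, K (x + f T * I)) atTop (𝓝 0) := by
    refine tendsto_intervalIntegral_of_norm_le hc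
      (g := fun T => g T + (‖r₁‖ * T⁻¹ + ‖r₂‖ * (T ^ 2)⁻¹ + ‖r₃‖ * (T ^ 3)⁻¹)) ?_ hf ?_
    · have hT (k : ℕ) : Tendsto (fun T : ℝ => (T ^ (k + 1))⁻¹) atTop (𝓝 0) :=
        tendsto_inv_atTop_zero.comp (tendsto_pow_atTop k.succ_ne_zero)
      have := hg.add ((((hT 0).const_mul ‖r₁‖).add ((hT 1).const_mul ‖r₂‖)).add
        ((hT 2).const_mul ‖r₃‖))
      simpa using this
    · intro x hx T hT
      have hT0 : 0 < |T| := by linarith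
      have him : |T| ≤ ‖(x + T * I : ℂ) - p‖ := by
        simpa using Complex.abs_im_le_norm ((x + T * I : ℂ) - p)
      have hne : (x + T * I : ℂ) ≠ p := fun h => by
        rw [h, sub_self, norm_zero] at him; linarith
      have hmem : (x + T * I : ℂ) ∈ U := hU _ (by simpa using hx.1) (by simpa using hx.2)
      have hle (r : ℂ) (k : ℕ) : ‖r * (((x + T * I : ℂ) - p) ^ k)⁻¹‖ ≤ ‖r‖ * (|T| ^ k)⁻¹ := by
        rw [norm_mul, norm_inv, norm_pow]
        gcongr
      rw [hKeq _ hmem hne]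
      refine (norm_sub_le _ _).trans (add_le_add (hgF x hx T hT) ?_)
      refine (norm_add₃_le).trans (add_le_add (add_le_add ?_ (hle r₂ 2)) (hle r₃ 3))
      simpa using hle r₁ 1
  -- On a vertical side the integral of `K` is that of `F` minus those of the principal part.
  have hvert (c : ℝ) (hcU : c₁ ≤ c ∧ c ≤ c₂) (hcp : c - p ≠ 0)
      (hi : Integrable fun t : ℝ => F (c + t * I)) {l : ℂ}
      (hl : Tendsto (fun T : ℝ => ∫ t in (-T)..T, ((c - p : ℝ) + t * I : ℂ)⁻¹) atTop (𝓝 l)) :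
      Tendsto (fun T : ℝ => ∫ t in (-T)..T, K (c + t * I)) atTop
        (𝓝 ((∫ t : ℝ, F (c + t * I)) - r₁ * l)) := by
    have hlim := ((intervalIntegral_tendsto_integral hi tendsto_neg_atTop_atBot tendsto_id).sub
      (((hl.const_mul r₁).add
        ((tendsto_intervalIntegral_inv_pow_vertical hcp 0).const_mul r₂)).add
        ((tendsto_intervalIntegral_inv_pow_vertical hcp 1).const_mul r₃)))
    simp only [mul_zero, add_zero] at hlim
    refine hlim.congr fun T => ?_
    have hii (k : ℕ) : IntervalIntegrable
        (fun t : ℝ => (((c - p : ℝ) + t * I : ℂ) ^ k)⁻¹) volume (-T) T :=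
      (Continuous.inv₀ (by fun_prop)
        fun t => pow_ne_zero _ (vertical_ne_zero hcp t)).intervalIntegrable _ _
    have hii1 := hii 1
    simp only [pow_one] at hii1
    simp only [id]
    rw [← intervalIntegral.integral_const_mul, ← intervalIntegral.integral_const_mul,
      ← intervalIntegral.integral_const_mul,
      ← intervalIntegral.integral_add (hii1.const_mul _) ((hii 2).const_mul _),
      ← intervalIntegral.integral_add ((hii1.const_mul _).add ((hii 2).const_mul _))
        ((hii 3).const_mul _),
      ← intervalIntegral.integral_sub hi.intervalIntegrable
        (((hii1.const_mul _).add ((hii 2).const_mul _)).add ((hii 3).const_mul _))]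
    refine intervalIntegral.integral_congr fun t _ => ?_
    have hsub : (c + t * I : ℂ) - p = ((c - p : ℝ) : ℂ) + t * I := by push_cast; ring
    have hne : (c + t * I : ℂ) ≠ p := fun h => by
      have := vertical_ne_zero hcp t
      rw [← hsub, h, sub_self] at this
      exact this rfl
    rw [hKeq _ (hU _ (by simpa using hcU.1) (by simpa using hcU.2)) hne, hsub]
  have hr := hvert c₂ ⟨hc, le_rfl⟩ (by linarith) hi₂
    (tendsto_intervalIntegral_inv_vertical (by linarith))
  have hl := hvert c₁ ⟨le_rfl, hc⟩ (by linarith) hi₁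
    (tendsto_intervalIntegral_inv_vertical_of_neg (by linarith))
  have hrect (T : ℝ) : (∫ x in c₁..c₂, K (x + (-T : ℝ) * I)) - (∫ x in c₁..c₂, K (x + T * I)) +
      I * (∫ t in (-T)..T, K (c₂ + t * I)) - I * (∫ t in (-T)..T, K (c₁ + t * I)) = 0 := by
    have := integral_boundary_rect_eq_zero_of_differentiableOn K (⟨c₁, -T⟩ : ℂ) ⟨c₂, T⟩
      (hK.mono fun s hs => by
        have h := hs.1
        simp only [uIcc_of_le hc, mem_preimage, mem_Icc] at h
        exact hU s h.1 h.2)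
    simpa [smul_eq_mul] using this
  have hlim := (((hKhor (fun T => -T) (by simp)).sub (hKhor id (by simp))).add
    (hr.const_mul I)).sub (hl.const_mul I)
  have hzero := tendsto_nhds_unique hlim
    ((tendsto_const_nhds (x := (0 : ℂ))).congr fun T => (hrect T).symm)
  have : I * (((∫ t : ℝ, F (c₂ + t * I)) - ∫ t : ℝ, F (c₁ + t * I)) - 2 * Real.pi * r₁) = 0 := by
    linear_combination hzero
  exact sub_eq_zero.1 ((mul_eq_zero.1 this).resolve_left I_ne_zero)

end ContourShift

/-! ### Euler's integral along a rotated ray -/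

section LaplaceGamma

open Complex MeasureTheory Set

lemma integrableOn_cpow_mul_exp_neg_mul {s z : ℂ} (hs : 0 < s.re) (hz : 0 < z.re) :
    IntegrableOn (fun t : ℝ => (t : ℂ) ^ (s - 1) * cexp (-z * t)) (Ioi 0) := by
  have h := integrableOn_rpow_mul_exp_neg_mul_rpow (p := 1) (s := s.re - 1) (b := z.re)
    (by linarith) one_pos hz
  refine h.mono' ?_ ?_
  · refine ContinuousOn.aestronglyMeasurable (fun t ht => ?_) measurableSet_Ioi
    have ht' : (t : ℂ) ∈ slitPlane := by simpa using ht
    refine ContinuousAt.continuousWithinAt ?_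
    refine ContinuousAt.mul ?_ (by fun_prop)
    exact (continuous_ofReal.continuousAt).cpow continuousAt_const ht'
  · refine (ae_restrict_iff' measurableSet_Ioi).2 (Eventually.of_forall fun t ht => ?_)
    have ht : 0 < t := ht
    rw [norm_mul, norm_cpow_eq_rpow_re_of_pos ht, norm_exp]
    simp

/-- The rotated form of Euler's integral. Both sides are holomorphic in `z` and agree for
`z > 0`. -/
theorem integral_cpow_mul_exp_neg_mul_of_re_pos {s z : ℂ} (hs : 0 < s.re) (hz : 0 < z.re) :
    ∫ t in Ioi (0 : ℝ), (t : ℂ) ^ (s - 1) * cexp (-z * t) = z ^ (-s) * Gamma s := by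
  set U : Set ℂ := {z | 0 < z.re} with hUdef
  have hU : IsOpen U := isOpen_lt continuous_const continuous_re
  have hUc : Convex ℝ U := convex_halfSpace_re_gt 0
  have hL : DifferentiableOn ℂ
      (fun z : ℂ => ∫ t in Ioi (0 : ℝ), (t : ℂ) ^ (s - 1) * cexp (-z * t)) U := by
    intro z₀ hz₀
    have hz₀ : 0 < z₀.re := hz₀
    refine DifferentiableAt.differentiableWithinAt ?_
    refine (hasDerivAt_integral_of_dominated_loc_of_deriv_le (𝕜 := ℂ)
      (F := fun z (t : ℝ) => (t : ℂ) ^ (s - 1) * cexp (-z * t)) (μ := volume.restrict (Ioi 0))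
      (F' := fun z (t : ℝ) => (t : ℂ) ^ (s - 1) * (cexp (-z * t) * (-t)))
      (bound := fun t => t ^ s.re * Real.exp (-(z₀.re / 2) * t ^ (1 : ℝ)))
      (s := {z | z₀.re / 2 < z.re})
      ((isOpen_lt continuous_const continuous_re).mem_nhds (by simpa using hz₀))
      ?_ (integrableOn_cpow_mul_exp_neg_mul hs hz₀) ?_ ?_ ?_ ?_).2.differentiableAt
    · filter_upwards [hU.mem_nhds hz₀] with w hw
      exact (integrableOn_cpow_mul_exp_neg_mul hs hw).aestronglyMeasurable
    · have := (integrableOn_cpow_mul_exp_neg_mul hs hz₀).aestronglyMeasurable.mul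
        (continuous_ofReal.neg.aestronglyMeasurable (μ := volume.restrict (Ioi (0 : ℝ))))
      refine this.congr (Eventually.of_forall fun t => ?_)
      simp [mul_assoc]
    · refine (ae_restrict_iff' measurableSet_Ioi).2 (Eventually.of_forall fun t ht w hw => ?_)
      have ht : 0 < t := ht
      have hw : z₀.re / 2 < w.re := hw
      rw [norm_mul, norm_mul, norm_cpow_eq_rpow_re_of_pos ht, norm_exp, norm_neg, norm_real,
        Real.norm_of_nonneg ht.le, Real.rpow_one]
      have h1 : t ^ (s - 1).re * (Real.exp (-w * t).re * t)
          = t ^ s.re * Real.exp (-(w.re * t)) := by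
        have : t ^ s.re = t ^ (s.re - 1) * t := by
          rw [← Real.rpow_add_one ht.ne']; simp
        rw [this]
        simp
        ring
      rw [h1]
      gcongr
      nlinarith
    · exact integrableOn_rpow_mul_exp_neg_mul_rpow (by linarith) one_pos (by linarith)
    · refine Eventually.of_forall fun t w _ => ?_
      have : HasDerivAt (fun w : ℂ => -w * (t : ℂ)) (-t) w := by
        simpa using (hasDerivAt_neg w).mul_const (t : ℂ)
      exact this.cexp.const_mul _
  have hR : DifferentiableOn ℂ (fun z : ℂ => z ^ (-s) * Gamma s) U := fun z hz =>
    ((differentiableAt_id.cpow_const (Or.inl hz)).mul_const _).differentiableWithinAt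
  refine (hL.analyticOnNhd hU).eqOn_of_preconnected_of_frequently_eq (hR.analyticOnNhd hU)
    hUc.isPreconnected (z₀ := 1) (by simp [hUdef]) ?_ hz
  have hseq : Tendsto (fun x : ℝ => (x : ℂ)) (𝓝[>] 1) (𝓝[≠] 1) := by
    refine tendsto_nhdsWithin_iff.2 ⟨?_, ?_⟩
    · exact (continuous_ofReal.tendsto' 1 1 (by simp)).mono_left nhdsWithin_le_nhds
    · filter_upwards [self_mem_nhdsWithin] with x hx
      simpa using (ne_of_gt hx : x ≠ 1)
  refine hseq.frequently (Eventually.frequently ?_)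
  filter_upwards [self_mem_nhdsWithin] with x hx
  have hx0 : 0 < x := zero_lt_one.trans hx
  have := integral_cpow_mul_exp_neg_mul_Ioi hs hx0
  simp only [neg_mul]
  rw [this, one_div, inv_cpow _ _ (by rw [arg_ofReal_of_nonneg hx0.le]; exact Real.pi_pos.ne),
    cpow_neg]

end LaplaceGamma

/-! ### Exponential growth on vertical strips, and the decay of the Gamma function -/

section VerticalGrowth

open Complex Set

/-- On every vertical strip, and away from the real axis, `f (σ + i t) = O(exp (κ |t|))`. -/
def VerticalExpBound (f : ℂ → ℂ) (κ : ℝ) : Prop :=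
  ∀ a b η : ℝ, 0 < η → ∃ C : ℝ, ∀ s : ℂ, a ≤ s.re → s.re ≤ b → η ≤ |s.im| →
    ‖f s‖ ≤ C * Real.exp (κ * |s.im|)

lemma VerticalExpBound.mul {f g : ℂ → ℂ} {κ κ' : ℝ} (hf : VerticalExpBound f κ)
    (hg : VerticalExpBound g κ') : VerticalExpBound (fun s => f s * g s) (κ + κ') := by
  intro a b η hη
  obtain ⟨C, hC⟩ := hf a b η hη
  obtain ⟨D, hD⟩ := hg a b η hη
  refine ⟨C * D, fun s h1 h2 h3 => ?_⟩
  have hc := hC s h1 h2 h3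
  rw [norm_mul, add_mul, Real.exp_add]
  calc _ ≤ (C * Real.exp (κ * |s.im|)) * (D * Real.exp (κ' * |s.im|)) :=
        mul_le_mul hc (hD s h1 h2 h3) (norm_nonneg _) ((norm_nonneg _).trans hc)
    _ = _ := by ring

lemma VerticalExpBound.neg {f : ℂ → ℂ} {κ : ℝ} (hf : VerticalExpBound f κ) :
    VerticalExpBound (fun s => -f s) κ := fun a b η hη => by
  simpa using hf a b η hη

lemma VerticalExpBound.deriv {f : ℂ → ℂ} {κ : ℝ} (hf : VerticalExpBound f κ)
    (hd : ∀ s : ℂ, s.im ≠ 0 → DifferentiableAt ℂ f s) : VerticalExpBound (deriv f) κ := by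
  intro a b η hη
  obtain ⟨C, hC⟩ := hf (a - η / 2) (b + η / 2) (η / 2) (by positivity)
  refine ⟨|C| * Real.exp (|κ| * (η / 2)) / (η / 2), fun s h1 h2 h3 => ?_⟩
  have hre (w : ℂ) : |w.re - s.re| ≤ dist w s := by
    simpa [dist_eq_norm] using abs_re_le_norm (w - s)
  have him (w : ℂ) : |w.im - s.im| ≤ dist w s := by
    simpa [dist_eq_norm] using abs_im_le_norm (w - s)
  have himle (w : ℂ) (hw : dist w s ≤ η / 2) : η / 2 ≤ |w.im| := by
    have := abs_sub_abs_le_abs_sub s.im w.im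
    rw [abs_sub_comm] at this
    linarith [him w]
  have hdiff : DifferentiableOn ℂ f (Metric.closedBall s (η / 2)) := fun w hw =>
    (hd w (abs_pos.1 (lt_of_lt_of_le (by positivity) (himle w hw)))).differentiableWithinAt
  have := norm_deriv_le_of_forall_mem_sphere_norm_le (C := |C| * Real.exp (|κ| * (η / 2)) *
    Real.exp (κ * |s.im|)) (by positivity : 0 < η / 2)
    (hdiff.diffContOnCl_ball subset_rfl) fun w hw => by
      have hw : dist w s = η / 2 := hw
      have hr := abs_le.1 ((hre w).trans hw.le)
      refine (hC w (by linarith) (by linarith) (himle w hw.le)).trans ?_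
      rw [mul_assoc, ← Real.exp_add]
      gcongr
      · exact le_abs_self C
      · have h4 : |(|w.im| - |s.im|)| ≤ η / 2 :=
          (abs_abs_sub_abs_le _ _).trans ((him w).trans hw.le)
        have h5 : κ * (|w.im| - |s.im|) ≤ |κ| * (η / 2) :=
          (le_abs_self _).trans (by rw [abs_mul]; gcongr)
        linarith
  refine this.trans (le_of_eq ?_)
  ring

lemma norm_Gamma_mul_exp_le {s : ℂ} (hs : 0 < s.re) {α : ℝ} (h0 : 0 ≤ α) (hα : α < Real.pi / 2) :
    ‖Gamma s‖ * Real.exp (α * |s.im|) ≤ Real.Gamma s.re * Real.cos α ^ (-s.re) := by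
  -- Rotating by an angle `β` with the sign of `im s` produces the factor `e^{α |im s|}`.
  obtain ⟨β, hβ, hβs⟩ : ∃ β : ℝ, |β| = α ∧ β * s.im = α * |s.im| := by
    rcases le_total 0 s.im with h | h
    · exact ⟨α, abs_of_nonneg h0, by rw [abs_of_nonneg h]⟩
    · exact ⟨-α, by rw [abs_neg, abs_of_nonneg h0], by rw [abs_of_nonpos h]; ring⟩
  have hβ' : β ∈ Ioc (-Real.pi) Real.pi := by
    have := abs_le.1 hβ.le
    constructor <;> linarith [Real.pi_pos]
  have hcos : 0 < Real.cos α := Real.cos_pos_of_mem_Ioo ⟨by linarith, hα⟩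
  have hre : (cexp (β * I)).re = Real.cos α := by
    rw [exp_ofReal_mul_I_re, ← Real.cos_abs, hβ]
  have h := integral_cpow_mul_exp_neg_mul_of_re_pos hs (z := cexp (β * I)) (by rw [hre]; exact hcos)
  have harg : (cexp (β * I)).arg = β := by
    rw [exp_mul_I, arg_cos_add_sin_mul_I hβ']
  have hn : ‖cexp (β * I) ^ (-s) * Gamma s‖ = ‖Gamma s‖ * Real.exp (α * |s.im|) := by
    rw [norm_mul, norm_cpow_of_ne_zero (exp_ne_zero _), harg, norm_exp_ofReal_mul_I,
      Real.one_rpow, neg_im, mul_neg, hβs, Real.exp_neg, one_div, inv_inv, mul_comm]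
  rw [← hn, ← h]
  refine (MeasureTheory.norm_integral_le_integral_norm _).trans (le_of_eq ?_)
  have h2 := Real.integral_rpow_mul_exp_neg_mul_Ioi hs hcos
  rw [Real.rpow_neg hcos.le, ← Real.inv_rpow hcos.le, mul_comm (Real.Gamma _), ← one_div, ← h2]
  refine MeasureTheory.setIntegral_congr_fun measurableSet_Ioi fun t ht => ?_
  have ht : 0 < t := ht
  simp only [norm_mul]
  rw [norm_cpow_eq_rpow_re_of_pos ht, norm_exp]
  simp [hre]

theorem verticalExpBound_Gamma {κ : ℝ} (hκ : -(Real.pi / 2) < κ) : VerticalExpBound Gamma κ := by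
  set α : ℝ := max (-κ) 0
  have hα0 : 0 ≤ α := le_max_right _ _
  have hα : α < Real.pi / 2 := max_lt (by linarith) (by positivity)
  have hακ : -α ≤ κ := by linarith [le_max_left (-κ) 0]
  have hcos : 0 < Real.cos α := Real.cos_pos_of_mem_Ioo ⟨by linarith, hα⟩
  have key (n : ℕ) : ∀ b η : ℝ, 0 < η → ∃ C : ℝ, ∀ s : ℂ, 1 - n ≤ s.re → s.re ≤ b → η ≤ |s.im| →
      ‖Gamma s‖ ≤ C * Real.exp (κ * |s.im|) := by
    induction n with
    | zero =>
      intro b η _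
      have hcont : ContinuousOn (fun σ : ℝ => Real.Gamma σ * Real.cos α ^ (-σ)) (Icc 1 b) := by
        refine ContinuousOn.mul (fun σ hσ => ?_) ?_
        · have hσ0 : 0 < σ := zero_lt_one.trans_le hσ.1
          exact (Real.differentiableAt_Gamma fun m => by
            have : (0 : ℝ) ≤ m := m.cast_nonneg
            linarith).continuousAt.continuousWithinAt
        · exact Continuous.continuousOn
            (continuous_const.rpow continuous_neg fun _ => Or.inl hcos.ne')
      obtain ⟨C, hC⟩ := isCompact_Icc.exists_bound_of_continuousOn hcont
      refine ⟨C, fun s h1 h2 _ => ?_⟩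
      have h1 : 1 ≤ s.re := by simpa using h1
      have hb := norm_Gamma_mul_exp_le (by linarith) hα0 hα (s := s)
      have hC' := (le_abs_self _).trans (hC s.re ⟨h1, h2⟩)
      have hC0 : 0 ≤ C := (norm_nonneg _).trans (hC s.re ⟨h1, h2⟩)
      calc ‖Gamma s‖ = ‖Gamma s‖ * Real.exp (α * |s.im|) * Real.exp (-(α * |s.im|)) := by
            rw [mul_assoc, ← Real.exp_add, add_neg_cancel, Real.exp_zero, mul_one]
        _ ≤ C * Real.exp (κ * |s.im|) := by
            gcongr
            · exact hb.trans hC'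
            · rw [← neg_mul]; gcongr
    | succ n ih =>
      intro b η hη
      obtain ⟨C, hC⟩ := ih (b + 1) η hη
      refine ⟨C / η, fun s h1 h2 h3 => ?_⟩
      have hs : η ≤ ‖s‖ := h3.trans (abs_im_le_norm s)
      have hs0 : s ≠ 0 := norm_pos_iff.1 (hη.trans_le hs)
      have h := hC (s + 1) (by push_cast at h1; simp; linarith) (by simpa using h2)
        (by simpa using h3)
      rw [Gamma_add_one s hs0, norm_mul] at h
      simp only [add_im, one_im, add_zero] at h
      rw [div_mul_eq_mul_div, le_div_iff₀ hη]
      calc ‖Gamma s‖ * η ≤ ‖Gamma s‖ * ‖s‖ := by gcongr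
        _ = ‖s‖ * ‖Gamma s‖ := mul_comm _ _
        _ ≤ _ := h
  intro a b η hη
  obtain ⟨n, hn⟩ := exists_nat_ge (1 - a)
  obtain ⟨C, hC⟩ := key n b η hη
  exact ⟨C, fun s h1 h2 h3 => hC s (by linarith) h2 h3⟩

end VerticalGrowth

/-! ### Euler–Maclaurin summation for the zeta function -/

section EulerMaclaurin

open Complex Set

/-- `(s - 1)` times the Euler–Maclaurin approximation
`∑_{k ≤ m} k⁻ˢ + m¹⁻ˢ / (s - 1) - m⁻ˢ / 2 + s m⁻ˢ⁻¹ / 12` of `ζ(s)` at `m = n + 1`. -/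
noncomputable def zetaApprox (n : ℕ) (s : ℂ) : ℂ :=
  (s - 1) * ∑ k ∈ Finset.range (n + 1), ((k + 1 : ℕ) : ℂ) ^ (-s) + ((n + 1 : ℕ) : ℂ) ^ (1 - s)
    - (s - 1) / 2 * ((n + 1 : ℕ) : ℂ) ^ (-s) + (s - 1) * s / 12 * ((n + 1 : ℕ) : ℂ) ^ (-s - 1)

lemma differentiable_zetaApprox (n : ℕ) : Differentiable ℂ (zetaApprox n) := by
  have h (k : ℕ) : ((k + 1 : ℕ) : ℂ) ≠ 0 := Nat.cast_ne_zero.2 k.succ_ne_zero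
  unfold zetaApprox
  have h1 (k : ℕ) : Differentiable ℂ fun s : ℂ => ((k + 1 : ℕ) : ℂ) ^ (-s) :=
    fun s => differentiableAt_id.neg.const_cpow (Or.inl (h k))
  have h2 (k : ℕ) : Differentiable ℂ fun s : ℂ => ((k + 1 : ℕ) : ℂ) ^ (1 - s) :=
    fun s => (differentiableAt_id.const_sub _).const_cpow (Or.inl (h k))
  have h3 (k : ℕ) : Differentiable ℂ fun s : ℂ => ((k + 1 : ℕ) : ℂ) ^ (-s - 1) :=
    fun s => (differentiableAt_id.neg.sub_const _).const_cpow (Or.inl (h k))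
  have h4 : Differentiable ℂ fun s : ℂ =>
      ∑ k ∈ Finset.range (n + 1), ((k + 1 : ℕ) : ℂ) ^ (-s) :=
    Differentiable.fun_sum fun k _ => h1 k
  have h5 := h1 n
  have h6 := h2 n
  have h7 := h3 n
  fun_prop

/-- The Euler–Maclaurin remainder over one unit interval. The difference of two consecutive
approximations is the increment over `[0, 1]` of a function whose derivative is
`B₃(x) / 6` times the third derivative of `(s - 1) (n + 1 + x)⁻ˢ`. -/
lemma norm_zetaApprox_succ_sub_le (n : ℕ) {s : ℂ} (hs : -3 ≤ s.re) :
    ‖zetaApprox (n + 1) s - zetaApprox n s‖ ≤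
      ‖(s - 1) * s * (s + 1) * (s + 2)‖ * ((n + 1 : ℕ) : ℝ) ^ (-s.re - 3) := by
  set c : ℂ := ((n + 1 : ℕ) : ℂ) with hc
  have hpos (x : ℝ) (hx : 0 ≤ x) : 0 < ((n + 1 : ℕ) : ℝ) + x := by positivity
  have hv (x : ℝ) : c + x = (((n + 1 : ℕ) : ℝ) + x : ℝ) := by push_cast [hc]; ring
  have hslit (x : ℝ) (hx : 0 ≤ x) : c + x ∈ slitPlane := by
    rw [hv]; exact ofReal_mem_slitPlane.2 (hpos x hx)
  have hpow (w : ℂ) (x : ℝ) (hx : 0 ≤ x) :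
      HasDerivAt (fun x : ℝ => (c + x) ^ w) (w * (c + x) ^ (w - 1)) x := by
    have h1 : HasDerivAt (fun x : ℝ => c + x) 1 x := by
      simpa using (hasDerivAt_id x).ofReal_comp.const_add c
    have h2 : HasDerivAt (fun z : ℂ => z ^ w) (w * (c + x) ^ (w - 1)) (c + x) :=
      (hasStrictDerivAt_cpow_const (hslit x hx)).hasDerivAt
    exact (h2.comp x h1).congr_deriv (mul_one _)
  set Φ : ℝ → ℂ := fun x =>
    (s - 1) * s * (s + 1) * ((x : ℂ) ^ 3 - 3 / 2 * x ^ 2 + x / 2) / 6 * (c + x) ^ (-s - 2)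
      + (s - 1) * s * ((x : ℂ) ^ 2 - x + 1 / 6) / 2 * (c + x) ^ (-s - 1)
      + (s - 1) * ((x : ℂ) - 1 / 2) * (c + x) ^ (-s) + (c + x) ^ (1 - s) with hΦ
  set Φ' : ℝ → ℂ := fun x =>
    -((s - 1) * s * (s + 1) * (s + 2)) * (((x : ℂ) ^ 3 - 3 / 2 * x ^ 2 + x / 2) / 6) *
      (c + x) ^ (-s - 3) with hΦ'
  have hder (x : ℝ) (hx : 0 ≤ x) : HasDerivAt Φ (Φ' x) x := by
    have hx1 : HasDerivAt (fun x : ℝ => (x : ℂ)) 1 x := (hasDerivAt_id x).ofReal_comp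
    have hx2 : HasDerivAt (fun x : ℝ => (x : ℂ) ^ 2) (2 * x) x := by simpa using hx1.fun_pow 2
    have hx3 : HasDerivAt (fun x : ℝ => (x : ℂ) ^ 3) (3 * x ^ 2) x := by
      simpa using hx1.fun_pow 3
    have t1 := ((((hx3.sub (hx2.const_mul (3 / 2 : ℂ))).add (hx1.div_const 2)).const_mul
      ((s - 1) * s * (s + 1))).div_const 6).mul (hpow (-s - 2) x hx)
    have t2 := ((((hx2.sub hx1).add_const (1 / 6 : ℂ)).const_mul ((s - 1) * s)).div_const 2).mul
      (hpow (-s - 1) x hx)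
    have t3 := ((hx1.sub_const (1 / 2 : ℂ)).const_mul (s - 1)).mul (hpow (-s) x hx)
    have t4 := hpow (1 - s) x hx
    refine (((t1.add t2).add t3).add t4).congr_deriv ?_
    simp only [hΦ', Pi.add_apply, Pi.sub_apply]
    rw [show -s - 2 - 1 = -s - 3 by ring, show -s - 1 - 1 = -s - 2 by ring,
      show 1 - s - 1 = -s by ring]
    ring
  have hdiff : zetaApprox (n + 1) s - zetaApprox n s = Φ 1 - Φ 0 := by
    have hc1 : ((n + 1 + 1 : ℕ) : ℂ) = c + 1 := by push_cast [hc]; ring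
    simp only [zetaApprox, hΦ]
    rw [Finset.sum_range_succ _ (n + 1), hc1, ← hc]
    push_cast
    simp only [add_zero]
    ring
  rw [hdiff]
  refine norm_image_sub_le_of_norm_deriv_le_segment_01' (f' := Φ')
    (fun x hx => (hder x hx.1).hasDerivWithinAt) fun x hx => ?_
  have hB : ‖((x : ℂ) ^ 3 - 3 / 2 * x ^ 2 + x / 2) / 6‖ ≤ 1 := by
    have : ((x : ℂ) ^ 3 - 3 / 2 * x ^ 2 + x / 2) / 6 =
        ((x ^ 3 - 3 / 2 * x ^ 2 + x / 2) / 6 : ℝ) := by push_cast; ring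
    rw [this, norm_real, Real.norm_eq_abs, abs_le]
    have h0 := hx.1
    have h1 := hx.2
    have h2 : x ^ 2 ≤ 1 := by nlinarith
    have h3 : 0 ≤ x ^ 3 := by positivity
    have h4 : x ^ 3 ≤ 1 := by nlinarith [mul_nonneg h0 h0]
    constructor <;> nlinarith
  have hP : ‖(c + x) ^ (-s - 3)‖ ≤ ((n + 1 : ℕ) : ℝ) ^ (-s.re - 3) := by
    rw [hv, norm_cpow_eq_rpow_re_of_pos (hpos x hx.1)]
    have : (-s - 3).re = -s.re - 3 := by simp
    rw [this]
    exact Real.rpow_le_rpow_of_nonpos (by positivity) (by linarith [hx.1]) (by linarith)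
  simp only [hΦ']
  rw [norm_mul, norm_mul, norm_neg]
  calc _ ≤ ‖(s - 1) * s * (s + 1) * (s + 2)‖ * 1 * ((n + 1 : ℕ) : ℝ) ^ (-s.re - 3) := by gcongr
    _ = _ := by ring

lemma tendsto_natCast_succ_cpow {w : ℂ} (hw : w.re < 0) :
    Tendsto (fun n : ℕ => ((n + 1 : ℕ) : ℂ) ^ w) atTop (𝓝 0) := by
  rw [tendsto_zero_iff_norm_tendsto_zero]
  have h : Tendsto (fun n : ℕ => ((n + 1 : ℕ) : ℝ) ^ w.re) atTop (𝓝 0) := by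
    have := (tendsto_rpow_neg_atTop (neg_pos.2 hw)).comp
      (tendsto_natCast_atTop_atTop.comp (tendsto_add_atTop_nat 1))
    simpa [Function.comp_def] using this
  refine h.congr fun n => ?_
  rw [norm_natCast_cpow_of_pos n.succ_pos]

lemma hasSum_natCast_succ_cpow {s : ℂ} (hs : 1 < s.re) :
    HasSum (fun n : ℕ => ((n + 1 : ℕ) : ℂ) ^ (-s)) (riemannZeta s) := by
  have h1 : Summable fun k : ℕ => 1 / (k : ℂ) ^ s := Complex.summable_one_div_nat_cpow.2 hs
  have h2 := ((summable_nat_add_iff 1).2 h1).hasSum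
  rw [zeta_eq_tsum_one_div_nat_add_one_cpow hs]
  simpa [cpow_neg] using h2

lemma tendsto_zetaApprox_of_one_lt_re {s : ℂ} (hs : 1 < s.re) :
    Tendsto (fun n => zetaApprox n s) atTop (𝓝 (riemannZeta₁ s)) := by
  have hs1 : s ≠ 1 := fun h => by simp [h] at hs
  have hsum := hasSum_natCast_succ_cpow hs
  have h1 := (hsum.tendsto_sum_nat.comp (tendsto_add_atTop_nat 1)).const_mul (s - 1)
  have h2 := tendsto_natCast_succ_cpow (w := 1 - s) (by simpa using hs)
  have h3 := (tendsto_natCast_succ_cpow (w := -s) (by simp; linarith)).const_mul ((s - 1) / 2)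
  have h4 := (tendsto_natCast_succ_cpow (w := -s - 1) (by simp; linarith)).const_mul
    ((s - 1) * s / 12)
  have := ((h1.add h2).sub h3).add h4
  simp only [mul_zero, add_zero, sub_zero] at this
  have hz : riemannZeta₁ s = (s - 1) * riemannZeta s := by
    rw [riemannZeta_eq_inv_sub_mul hs1, mul_inv_cancel_left₀ (sub_ne_zero.2 hs1)]
  rw [hz]
  exact this

/-- The increments of `zetaApprox` are summably bounded on bounded parts of `re s > -3/2`. -/
lemma norm_zetaApprox_succ_sub_le_of_norm_lt (n : ℕ) {s : ℂ} {R : ℝ} (hs : -3 / 2 < s.re)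
    (hR : ‖s‖ < R) : ‖zetaApprox (n + 1) s - zetaApprox n s‖ ≤
      (R + 2) ^ 4 * ((n + 1 : ℕ) : ℝ) ^ (-3 / 2 : ℝ) := by
  have hR0 : 0 ≤ R := (norm_nonneg s).trans hR.le
  refine (norm_zetaApprox_succ_sub_le n (by linarith)).trans ?_
  have hle (a : ℂ) (ha : ‖a‖ ≤ 2) : ‖s + a‖ ≤ R + 2 := (norm_add_le _ _).trans (by linarith)
  have h1 : ‖s - 1‖ ≤ R + 2 := by simpa [sub_eq_add_neg] using hle (-1) (by simp)
  have h2 : ‖s‖ ≤ R + 2 := by linarith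
  have h3 := hle 1 (by simp)
  have h4 := hle 2 (by simp)
  gcongr ?_ * ?_
  · rw [norm_mul, norm_mul, norm_mul]
    calc _ ≤ (R + 2) * (R + 2) * (R + 2) * (R + 2) := by gcongr
      _ = _ := by ring
  · exact Real.rpow_le_rpow_of_exponent_le (by simp) (by linarith)

lemma summable_natCast_succ_rpow : Summable fun n : ℕ => ((n + 1 : ℕ) : ℝ) ^ (-3 / 2 : ℝ) :=
  (summable_nat_add_iff 1).2 (Real.summable_nat_rpow.2 (by norm_num))

/-- Euler–Maclaurin summation for `(s - 1) ζ(s)`, together with its derivative, for `re s > -3/2`: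
both sides are holomorphic, and they agree where the Dirichlet series converges. -/
theorem hasSum_zetaApprox {s : ℂ} (hs : -3 / 2 < s.re) :
    HasSum (fun n => zetaApprox (n + 1) s - zetaApprox n s) (riemannZeta₁ s - zetaApprox 0 s) ∧
    HasSum (fun n => deriv (zetaApprox (n + 1)) s - deriv (zetaApprox n) s)
      (deriv riemannZeta₁ s - deriv (zetaApprox 0) s) := by
  set R : ℝ := ‖s‖ + 3
  set U : Set ℂ := {z | -3 / 2 < z.re} ∩ Metric.ball 0 R
  have hUo : IsOpen U := (isOpen_lt continuous_const continuous_re).inter Metric.isOpen_ball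
  have hUc : Convex ℝ U := (convex_halfSpace_re_gt _).inter (convex_ball _ _)
  have hsU : s ∈ U := ⟨hs, by simp [R]⟩
  have h2U : (2 : ℂ) ∈ U := ⟨by norm_num, by simp [R]; linarith [norm_nonneg s]⟩
  have hdn (n : ℕ) : Differentiable ℂ fun z => zetaApprox (n + 1) z - zetaApprox n z :=
    (differentiable_zetaApprox _).sub (differentiable_zetaApprox _)
  have hbound (n : ℕ) (z : ℂ) (hz : z ∈ U) := norm_zetaApprox_succ_sub_le_of_norm_lt n (R := R)
    hz.1 (by simpa using hz.2)
  have hsb : Summable fun n : ℕ => (R + 2) ^ 4 * ((n + 1 : ℕ) : ℝ) ^ (-3 / 2 : ℝ) :=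
    summable_natCast_succ_rpow.mul_left _
  set S : ℂ → ℂ := fun z => ∑' n, (zetaApprox (n + 1) z - zetaApprox n z)
  have hSd : DifferentiableOn ℂ S U := differentiableOn_tsum_of_summable_norm hsb
    (fun n => (hdn n).differentiableOn) hUo hbound
  have hS (z : ℂ) (hz : z ∈ U) : HasSum (fun n => zetaApprox (n + 1) z - zetaApprox n z) (S z) :=
    (Summable.of_norm_bounded hsb fun n => hbound n z hz).hasSum
  have hlim (z : ℂ) (hz : z ∈ U) :
      Tendsto (fun n => zetaApprox n z) atTop (𝓝 (S z + zetaApprox 0 z)) := by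
    refine ((hS z hz).tendsto_sum_nat.add_const (zetaApprox 0 z)).congr fun n => ?_
    rw [Finset.sum_range_sub (fun n => zetaApprox n z), sub_add_cancel]
  have hEq : EqOn S (fun z => riemannZeta₁ z - zetaApprox 0 z) U := by
    refine (hSd.analyticOnNhd hUo).eqOn_of_preconnected_of_eventuallyEq
      ((differentiable_riemannZeta₁.sub
        (differentiable_zetaApprox 0)).differentiableOn.analyticOnNhd hUo) hUc.isPreconnected h2U ?_
    filter_upwards [hUo.mem_nhds h2U, (isOpen_lt continuous_const continuous_re).mem_nhds
      (show (1 : ℝ) < (2 : ℂ).re by norm_num)] with z hz hz1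
    exact eq_sub_of_add_eq (tendsto_nhds_unique (hlim z hz) (tendsto_zetaApprox_of_one_lt_re hz1))
  refine ⟨by simpa [hEq hsU] using hS s hsU, ?_⟩
  have := hasSum_deriv_of_summable_norm hsb (fun n => (hdn n).differentiableOn) hUo hbound hsU
  have h1 : deriv S s = deriv riemannZeta₁ s - deriv (zetaApprox 0) s := by
    rw [(hEq.eventuallyEq_of_mem (hUo.mem_nhds hsU)).deriv_eq]
    exact deriv_fun_sub (differentiable_riemannZeta₁ s) (differentiable_zetaApprox 0 s)
  rw [h1] at this
  refine this.congr_fun fun n => ?_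
  exact (deriv_fun_sub (differentiable_zetaApprox _ s) (differentiable_zetaApprox _ s)).symm

end EulerMaclaurin

/-! ### The Glaisher–Kinkelin constant -/

section Glaisher

open Complex Set

lemma hasDerivAt_zetaApprox_neg_one (n : ℕ) :
    HasDerivAt (zetaApprox n) (2 * (glaisherSeq (n + 1) - 1 / 12 : ℝ) - 1 / 12) (-1) := by
  have h0 (k : ℕ) : ((k + 1 : ℕ) : ℂ) ≠ 0 := Nat.cast_ne_zero.2 k.succ_ne_zero
  have hlog (k : ℕ) : Complex.log ((k + 1 : ℕ) : ℂ) = (Real.log (k + 1 : ℕ) : ℂ) := by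
    rw [natCast_log]
  have hs1 : HasDerivAt (fun s : ℂ => s - 1) 1 (-1) := (hasDerivAt_id _).sub_const 1
  have h1 (k : ℕ) : HasDerivAt (fun s : ℂ => ((k + 1 : ℕ) : ℂ) ^ (-s))
      (-(((k + 1 : ℕ) : ℂ) * Real.log (k + 1 : ℕ))) (-1) := by
    have := (hasDerivAt_neg (-1 : ℂ)).const_cpow (c := ((k + 1 : ℕ) : ℂ)) (Or.inl (h0 k))
    refine this.congr_deriv ?_
    rw [neg_neg, cpow_one, hlog]
    ring
  have h2 : HasDerivAt (fun s : ℂ => ((n + 1 : ℕ) : ℂ) ^ (1 - s))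
      (-(((n + 1 : ℕ) : ℂ) ^ 2 * Real.log (n + 1 : ℕ))) (-1) := by
    have := ((hasDerivAt_id (-1 : ℂ)).const_sub 1).const_cpow (c := ((n + 1 : ℕ) : ℂ))
      (Or.inl (h0 n))
    refine this.congr_deriv ?_
    rw [show (1 - id (-1) : ℂ) = (2 : ℕ) by norm_num, cpow_natCast, hlog]
    ring
  have h3 : HasDerivAt (fun s : ℂ => ((n + 1 : ℕ) : ℂ) ^ (-s - 1))
      (-(Real.log (n + 1 : ℕ) : ℂ)) (-1) := by
    have := ((hasDerivAt_neg (-1 : ℂ)).sub_const 1).const_cpow (c := ((n + 1 : ℕ) : ℂ))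
      (Or.inl (h0 n))
    refine this.congr_deriv ?_
    rw [neg_neg, sub_self, cpow_zero, hlog]
    ring
  have hsum :
      HasDerivAt (fun s : ℂ => ∑ k ∈ Finset.range (n + 1), ((k + 1 : ℕ) : ℂ) ^ (-s)) _ (-1) :=
    HasDerivAt.fun_sum fun k _ => h1 k
  have := (((hs1.mul hsum).add h2).sub ((hs1.div_const 2).mul (h1 n))).add
    (((hs1.mul (hasDerivAt_id (-1 : ℂ))).div_const 12).mul h3)
  refine this.congr_deriv ?_
  have hS : (∑ k ∈ Finset.Icc 1 (n + 1), (k : ℝ) * Real.log k) =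
      ∑ k ∈ Finset.range (n + 1), ((k + 1 : ℕ) : ℝ) * Real.log (k + 1 : ℕ) := by
    rw [Finset.range_eq_Ico, Finset.sum_Ico_add' (fun k : ℕ => (k : ℝ) * Real.log k) 0 (n + 1) 1]
    rfl
  have hG : (∑ k ∈ Finset.range (n + 1), ((k + 1 : ℕ) : ℂ)) = (n + 1) * (n + 2) / 2 := by
    clear this hsum h3 h2 hS
    induction n with
    | zero => simp
    | succ m ih => rw [Finset.sum_range_succ, ih]; push_cast; ring
  rw [glaisherSeq, hS]
  simp only [neg_neg, cpow_one, sub_self, cpow_zero, Finset.sum_neg_distrib, Pi.mul_apply,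
    id, hG]
  push_cast
  ring

lemma riemannZeta_neg_one : riemannZeta (-1) = -1 / 12 := by
  have := riemannZeta_neg_nat_eq_bernoulli' 1
  norm_num [bernoulli'_two] at this
  simpa [div_eq_mul_inv] using this

/-- Euler–Maclaurin summation at `s = -1` identifies the Glaisher–Kinkelin constant:
`log A = 1/12 - ζ'(-1)`. -/
theorem tendsto_glaisherSeq :
    Tendsto (fun n => (glaisherSeq n : ℂ)) atTop (𝓝 (1 / 12 - deriv riemannZeta (-1))) := by
  have h := (hasSum_zetaApprox (s := -1) (by norm_num)).2.tendsto_sum_nat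
  have hd : deriv riemannZeta₁ (-1) = -1 / 12 - 2 * deriv riemannZeta (-1) := by
    have h1 := riemannZeta_eq_inv_sub_mul (s := -1) (by norm_num)
    have h2 := deriv_riemannZeta_eq_neg_inv_sub_sq_mul_add (s := -1) (by norm_num)
    rw [riemannZeta_neg_one] at h1
    norm_num at h1 h2
    linear_combination 2 * h2 + h1
  have h' : Tendsto (fun n => deriv (zetaApprox n) (-1)) atTop (𝓝 (deriv riemannZeta₁ (-1))) := by
    have h1 := h.add_const (deriv (zetaApprox 0) (-1))
    rw [sub_add_cancel] at h1
    refine h1.congr fun n => ?_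
    rw [Finset.sum_range_sub (fun n => deriv (zetaApprox n) (-1)), sub_add_cancel]
  simp only [(hasDerivAt_zetaApprox_neg_one _).deriv, hd] at h'
  rw [← tendsto_add_atTop_iff_nat 1]
  have := (h'.add_const (1 / 12 + 2 / 12 : ℂ)).div_const 2
  convert this using 2
  · push_cast; ring
  · ring

theorem ofReal_log_glaisherKinkelin :
    (Real.log glaisherKinkelin : ℂ) = 1 / 12 - deriv riemannZeta (-1) ∧
    Tendsto glaisherSeq atTop (𝓝 (Real.log glaisherKinkelin)) := by
  have hre := (continuous_re.tendsto _).comp tendsto_glaisherSeq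
  have h : Tendsto glaisherSeq atTop (𝓝 (1 / 12 - deriv riemannZeta (-1)).re) := hre
  have hlog : Real.log glaisherKinkelin = (1 / 12 - deriv riemannZeta (-1)).re := by
    rw [glaisherKinkelin, Real.log_exp, h.limUnder_eq]
  refine ⟨?_, hlog ▸ h⟩
  exact tendsto_nhds_unique ((continuous_ofReal.tendsto _).comp (hlog ▸ h)) tendsto_glaisherSeq

end Glaisher

/-! ### Growth of the zeta function on vertical strips -/

section ZetaGrowth

open Complex Set

lemma norm_riemannZeta₁_le {s : ℂ} (hs : -3 / 2 < s.re) :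
    ‖riemannZeta₁ s‖ ≤
      (∑' n : ℕ, ((n + 1 : ℕ) : ℝ) ^ (-3 / 2 : ℝ) + 1) * (‖s‖ + 3) ^ 4 := by
  have hb (n : ℕ) := norm_zetaApprox_succ_sub_le_of_norm_lt n hs (lt_add_one ‖s‖)
  have hsum := tsum_of_norm_bounded (summable_natCast_succ_rpow.mul_left ((‖s‖ + 1 + 2) ^ 4)).hasSum
    hb
  rw [(hasSum_zetaApprox hs).1.tsum_eq, tsum_mul_left] at hsum
  have h0 : ‖zetaApprox 0 s‖ ≤ (‖s‖ + 3) ^ 4 := by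
    have heq : zetaApprox 0 s = (s - 1) + 1 - (s - 1) / 2 + (s - 1) * s / 12 := by
      simp [zetaApprox]
    have h1 : ‖s - 1‖ ≤ ‖s‖ + 1 := by simpa using norm_sub_le s 1
    have h2 : ‖zetaApprox 0 s‖ ≤ ‖s - 1‖ + 1 + ‖s - 1‖ / 2 + ‖s - 1‖ * ‖s‖ / 12 := by
      rw [heq]
      refine (norm_add_le _ _).trans (add_le_add ((norm_sub_le _ _).trans (add_le_add
        ((norm_add_le _ _).trans (by simp)) (by simp))) (by simp))
    have hn := norm_nonneg s
    nlinarith [pow_nonneg hn 2, pow_nonneg hn 3, pow_nonneg hn 4, mul_le_mul_of_nonneg_right h1 hn]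
  have h3 := norm_sub_norm_le (riemannZeta₁ s) (zetaApprox 0 s)
  rw [show ‖s‖ + 1 + 2 = ‖s‖ + 3 by ring] at hsum
  linarith

/-- To the right of `re s = -3/2`, the zeta function grows at most polynomially. -/
lemma exists_norm_riemannZeta_le_right {κ : ℝ} (hκ : 0 < κ) (b : ℝ) {η : ℝ} (hη : 0 < η) :
    ∃ C : ℝ, ∀ s : ℂ, -5 / 4 ≤ s.re → s.re ≤ b → η ≤ |s.im| →
      ‖riemannZeta s‖ ≤ C * Real.exp (κ * |s.im|) := by
  set S : ℝ := ∑' n : ℕ, ((n + 1 : ℕ) : ℝ) ^ (-3 / 2 : ℝ) + 1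
  have hS : 0 ≤ S := add_nonneg (tsum_nonneg fun n => by positivity) zero_le_one
  set B : ℝ := |b| + 2 + 3
  refine ⟨η⁻¹ * (S * (24 / κ ^ 4 * Real.exp (κ * B))), fun s h1 h2 h3 => ?_⟩
  have him : |s.im| ≤ ‖s - 1‖ := by simpa using abs_im_le_norm (s - 1)
  have hs1 : s ≠ 1 := fun h => by
    rw [h] at h3
    simp at h3
    linarith
  have hre : |s.re| ≤ |b| + 2 := abs_le.2 ⟨by linarith [abs_nonneg b], by linarith [le_abs_self b]⟩
  have hn : ‖s‖ + 3 ≤ B + |s.im| := by linarith [norm_le_abs_re_add_abs_im s]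
  -- From `x⁴ / 4! ≤ eˣ` at `x = κ (B + |im s|)`.
  have hpoly : (B + |s.im|) ^ 4 ≤ 24 / κ ^ 4 * Real.exp (κ * B) * Real.exp (κ * |s.im|) := by
    have hx : 0 ≤ κ * (B + |s.im|) := by positivity
    have := Real.pow_div_factorial_le_exp _ hx 4
    rw [mul_assoc, ← Real.exp_add, ← mul_add]
    rw [div_mul_eq_mul_div, le_div_iff₀ (by positivity)]
    rw [mul_pow, div_le_iff₀ (by positivity)] at this
    norm_num [Nat.factorial] at this
    linarith
  rw [riemannZeta_eq_inv_sub_mul hs1, norm_mul, norm_inv]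
  calc ‖s - 1‖⁻¹ * ‖riemannZeta₁ s‖ ≤ η⁻¹ * (S * (‖s‖ + 3) ^ 4) := by
        gcongr
        · exact h3.trans him
        · exact norm_riemannZeta₁_le (by linarith)
    _ ≤ η⁻¹ * (S * (24 / κ ^ 4 * Real.exp (κ * B) * Real.exp (κ * |s.im|))) := by
        gcongr
        exact (by gcongr : (‖s‖ + 3) ^ 4 ≤ (B + |s.im|) ^ 4).trans hpoly
    _ = _ := by ring

lemma norm_cos_le_exp_abs_im (z : ℂ) : ‖Complex.cos z‖ ≤ Real.exp |z.im| := by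
  rw [Complex.cos, norm_div]
  have h1 : ‖cexp (z * I)‖ ≤ Real.exp |z.im| := by
    rw [norm_exp]
    exact Real.exp_le_exp.2 (by simpa using neg_le_abs z.im)
  have h2 : ‖cexp (-z * I)‖ ≤ Real.exp |z.im| := by
    rw [norm_exp]
    exact Real.exp_le_exp.2 (by simpa using le_abs_self z.im)
  have := norm_add_le (cexp (z * I)) (cexp (-z * I))
  rw [Complex.norm_ofNat]
  linarith

/-- The zeta function grows more slowly than any `exp (κ |t|)`, `κ > 0`, on vertical strips. To the
left this is read off from the functional equation, where the decay of `Γ` compensates the growth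
of the cosine up to an arbitrarily small exponential factor. -/
theorem verticalExpBound_riemannZeta {κ : ℝ} (hκ : 0 < κ) : VerticalExpBound riemannZeta κ := by
  intro a b η hη
  obtain ⟨C₁, hC₁⟩ := exists_norm_riemannZeta_le_right hκ b hη
  obtain ⟨C₂, hC₂⟩ := exists_norm_riemannZeta_le_right (half_pos hκ) (1 - a) hη
  obtain ⟨D, hD⟩ := verticalExpBound_Gamma (κ := κ / 2 - Real.pi / 2) (by linarith) 2 (1 - a) η hη
  refine ⟨max C₁ (2 * (D * C₂)), fun s h1 h2 h3 => ?_⟩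
  rcases le_total (-5 / 4) s.re with h | h
  · exact (hC₁ s h h2 h3).trans (by gcongr; exact le_max_left _ _)
  set w : ℂ := 1 - s with hw
  have hwre : w.re = 1 - s.re := by simp [hw]
  have hwim : |w.im| = |s.im| := by simp [hw]
  have hws : s = 1 - w := by rw [hw]; ring
  have hΓ := hD w (by linarith) (by linarith) (by rwa [hwim])
  have hζ := hC₂ w (by linarith) (by linarith) (by rwa [hwim])
  have hcos : ‖Complex.cos (Real.pi * w / 2)‖ ≤ Real.exp (Real.pi / 2 * |s.im|) := by
    refine (norm_cos_le_exp_abs_im _).trans (Real.exp_le_exp.2 (le_of_eq ?_))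
    rw [← hwim, show (Real.pi * w / 2 : ℂ) = ((Real.pi / 2 : ℝ) : ℂ) * w by push_cast; ring,
      im_ofReal_mul, abs_mul, abs_of_pos (by positivity)]
  have hpow : ‖(2 * Real.pi : ℂ) ^ (-w)‖ ≤ 1 := by
    rw [show (2 * Real.pi : ℂ) = ((2 * Real.pi : ℝ) : ℂ) by push_cast; ring,
      norm_cpow_eq_rpow_re_of_pos (by positivity)]
    exact Real.rpow_le_one_of_one_le_of_nonpos (by linarith [Real.pi_gt_three])
      (by rw [neg_re]; linarith)
  have hne (n : ℕ) : w ≠ -n := fun hn => by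
    have := congrArg re hn
    simp at this
    have : (0 : ℝ) ≤ n := n.cast_nonneg
    linarith
  have hne1 : w ≠ 1 := fun hn => by
    have := congrArg re hn
    simp at this
    linarith
  have hΓ0 := (norm_nonneg _).trans hΓ
  have hζ0 := (norm_nonneg _).trans hζ
  rw [hws, riemannZeta_one_sub hne hne1, ← hws, norm_mul, norm_mul, norm_mul, norm_mul,
    Complex.norm_ofNat]
  rw [hwim] at hΓ hζ hΓ0 hζ0
  calc _ ≤ 2 * 1 * (D * Real.exp ((κ / 2 - Real.pi / 2) * |s.im|)) *
        Real.exp (Real.pi / 2 * |s.im|) * (C₂ * Real.exp (κ / 2 * |s.im|)) := by gcongr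
    _ = 2 * (D * C₂) * (Real.exp ((κ / 2 - Real.pi / 2) * |s.im|) *
        Real.exp (Real.pi / 2 * |s.im|) * Real.exp (κ / 2 * |s.im|)) := by ring
    _ = 2 * (D * C₂) * Real.exp (κ * |s.im|) := by
        rw [← Real.exp_add, ← Real.exp_add]
        congr 2
        ring
    _ ≤ _ := by gcongr; exact le_max_right _ _

lemma ne_one_of_im_ne_zero {s : ℂ} (hs : s.im ≠ 0) : s ≠ 1 := fun h => hs (by simp [h])

/-- `Γ(s) ζ(s) (-ζ'(s))`, the Mellin transform of the Lambert series of the logarithm. -/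
noncomputable def lambertMellin (s : ℂ) : ℂ :=
  Gamma s * (riemannZeta s * -deriv riemannZeta s)

theorem verticalExpBound_lambertMellin {κ : ℝ} (hκ : -(Real.pi / 2) < κ) :
    VerticalExpBound lambertMellin κ := by
  set ε : ℝ := (κ + Real.pi / 2) / 3
  have hε : 0 < ε := by simp only [ε]; linarith
  have hζ := verticalExpBound_riemannZeta hε
  have hζ' := (hζ.deriv fun s hs => differentiableAt_riemannZeta (ne_one_of_im_ne_zero hs)).neg
  have hΓ : VerticalExpBound Gamma (κ - 2 * ε) :=
    verticalExpBound_Gamma (by simp only [ε]; linarith)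
  have := hΓ.mul (hζ.mul hζ')
  rwa [show κ - 2 * ε + (ε + ε) = κ by ring] at this

lemma differentiableAt_deriv_riemannZeta {s : ℂ} (hs : s ≠ 1) :
    DifferentiableAt ℂ (deriv riemannZeta) s :=
  ((differentiableOn_riemannZeta.deriv isOpen_compl_singleton).differentiableAt
    (isOpen_compl_singleton.mem_nhds hs))

lemma differentiableAt_lambertMellin {s : ℂ} (h1 : s ≠ 1) (hs : ∀ n : ℕ, s ≠ -n) :
    DifferentiableAt ℂ lambertMellin s :=
  (differentiableAt_Gamma s hs).mul
    ((differentiableAt_riemannZeta h1).mul (differentiableAt_deriv_riemannZeta h1).neg)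

end ZetaGrowth

/-! ### Mellin–Barnes integrals -/

section MellinLine

open Complex MeasureTheory Set

lemma integrable_exp_mul_abs_of_neg {κ : ℝ} (hκ : κ < 0) :
    Integrable fun t : ℝ => Real.exp (κ * |t|) := by
  rw [← integrableOn_univ, ← Iic_union_Ioi (a := (0 : ℝ)), integrableOn_union]
  constructor
  · refine (integrableOn_exp_mul_Iic (neg_pos.2 hκ) 0).congr_fun (fun t ht => ?_) measurableSet_Iic
    rw [abs_of_nonpos ht]; ring_nf
  · refine (integrableOn_exp_mul_Ioi hκ 0).congr_fun (fun t ht => ?_) measurableSet_Ioi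
    rw [abs_of_pos ht]

lemma VerticalExpBound.exists_bound_line {f : ℂ → ℂ} {κ : ℝ} (hf : VerticalExpBound f κ) {c : ℝ}
    (hc : Continuous fun t : ℝ => f (c + t * I)) :
    ∃ C : ℝ, ∀ t : ℝ, ‖f (c + t * I)‖ ≤ C * Real.exp (κ * |t|) := by
  obtain ⟨C, hC⟩ := hf c c 1 one_pos
  obtain ⟨D, hD⟩ := (isCompact_Icc (a := (-1 : ℝ)) (b := 1)).exists_bound_of_continuousOn
    hc.continuousOn
  have hD0 : 0 ≤ D := (norm_nonneg _).trans (hD 0 (by simp))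
  refine ⟨max C (D * Real.exp |κ|), fun t => ?_⟩
  rcases le_total 1 |t| with h | h
  · refine (by simpa using hC (c + t * I) (by simp) (by simp) (by simpa using h) :
      ‖f (c + t * I)‖ ≤ C * Real.exp (κ * |t|)).trans ?_
    gcongr
    exact le_max_left _ _
  · refine (hD t (abs_le.1 h)).trans ?_
    calc D = D * Real.exp |κ| * Real.exp (-|κ|) := by
          rw [mul_assoc, ← Real.exp_add, add_neg_cancel, Real.exp_zero, mul_one]
      _ ≤ D * Real.exp |κ| * Real.exp (κ * |t|) := by
          gcongr
          have : abs (κ * |t|) ≤ |κ| := by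
            rw [abs_mul, abs_abs]; exact mul_le_of_le_one_right (abs_nonneg _) h
          exact (abs_le.1 this).1
      _ ≤ _ := by gcongr; exact le_max_right _ _

lemma norm_cpow_neg_le {y : ℂ} (hy : y ≠ 0) {θ : ℝ} (hθ : |y.arg| ≤ θ) (s : ℂ) :
    ‖y ^ (-s)‖ ≤ ‖y‖ ^ (-s.re) * Real.exp (θ * |s.im|) := by
  rw [norm_cpow_of_ne_zero hy, neg_re, neg_im, div_eq_mul_inv, ← Real.exp_neg]
  gcongr
  calc -(y.arg * -s.im) = y.arg * s.im := by ring
    _ ≤ |y.arg| * |s.im| := by rw [← abs_mul]; exact le_abs_self _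
    _ ≤ _ := by gcongr

/-- The Mellin–Barnes integral `(2πi)⁻¹ ∫ f(s) y⁻ˢ ds` along the line `re s = c`. -/
noncomputable def mellinLine (f : ℂ → ℂ) (c : ℝ) (y : ℂ) : ℂ :=
  (2 * Real.pi : ℂ)⁻¹ * ∫ t : ℝ, f (c + t * I) * y ^ (-(c + t * I : ℂ))

lemma VerticalExpBound.exists_bound_mul_cpow {f : ℂ → ℂ} {κ : ℝ} (hf : VerticalExpBound f κ) {c : ℝ}
    (hc : Continuous fun t : ℝ => f (c + t * I)) (θ : ℝ) :
    ∃ C : ℝ, ∀ y : ℂ, y ≠ 0 → |y.arg| ≤ θ → ∀ t : ℝ,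
      ‖f (c + t * I) * y ^ (-(c + t * I : ℂ))‖ ≤
        C * ‖y‖ ^ (-c) * Real.exp ((κ + θ) * |t|) := by
  obtain ⟨C, hC⟩ := hf.exists_bound_line hc
  refine ⟨C, fun y hy hθ t => ?_⟩
  have h := norm_cpow_neg_le hy hθ (c + t * I)
  simp only [add_re, ofReal_re, mul_re, I_re, mul_zero, ofReal_im, I_im, mul_one, sub_self,
    add_zero, add_im, mul_im, zero_add] at h
  rw [norm_mul, add_mul, Real.exp_add]
  calc _ ≤ (C * Real.exp (κ * |t|)) * (‖y‖ ^ (-c) * Real.exp (θ * |t|)) :=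
        mul_le_mul (hC t) h (norm_nonneg _) ((norm_nonneg _).trans (hC t))
    _ = _ := by ring

lemma continuous_mul_cpow_vertical {f : ℂ → ℂ} {c : ℝ} (hc : Continuous fun t : ℝ => f (c + t * I))
    {y : ℂ} (hy : y ≠ 0) : Continuous fun t : ℝ => f (c + t * I) * y ^ (-(c + t * I : ℂ)) :=
  hc.mul (Continuous.const_cpow (by fun_prop) (Or.inl hy))

lemma VerticalExpBound.integrable_mul_cpow {f : ℂ → ℂ} {κ : ℝ} (hf : VerticalExpBound f κ) {c : ℝ}
    (hc : Continuous fun t : ℝ => f (c + t * I)) {y : ℂ} (hy : y ≠ 0) (hκ : κ + |y.arg| < 0) :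
    Integrable fun t : ℝ => f (c + t * I) * y ^ (-(c + t * I : ℂ)) := by
  obtain ⟨C, hC⟩ := hf.exists_bound_mul_cpow hc |y.arg|
  exact ((integrable_exp_mul_abs_of_neg hκ).const_mul _).mono'
    (continuous_mul_cpow_vertical hc hy).aestronglyMeasurable
    (Eventually.of_forall (hC y hy le_rfl))

lemma VerticalExpBound.exists_norm_mellinLine_le {f : ℂ → ℂ} {κ : ℝ} (hf : VerticalExpBound f κ)
    {c : ℝ} (hc : Continuous fun t : ℝ => f (c + t * I)) {θ : ℝ} (hκ : κ + θ < 0) :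
    ∃ C : ℝ, ∀ y : ℂ, y ≠ 0 → |y.arg| ≤ θ → ‖mellinLine f c y‖ ≤ C * ‖y‖ ^ (-c) := by
  obtain ⟨C, hC⟩ := hf.exists_bound_mul_cpow hc θ
  refine ⟨‖(2 * Real.pi : ℂ)⁻¹‖ * (C * ∫ t : ℝ, Real.exp ((κ + θ) * |t|)), fun y hy hθ => ?_⟩
  have := norm_integral_le_of_norm_le ((integrable_exp_mul_abs_of_neg hκ).const_mul _)
    (Eventually.of_forall (hC y hy hθ))
  rw [integral_const_mul] at this
  rw [mellinLine, norm_mul, mul_assoc]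
  gcongr
  refine this.trans (le_of_eq (by ring))

/-- Moving the line of a Mellin–Barnes integral across a pole at the real point `p`. -/
theorem VerticalExpBound.mellinLine_sub_eq {f K : ℂ → ℂ} {κ : ℝ} (hf : VerticalExpBound f κ)
    {c₁ c₂ p : ℝ} {y r₁ r₂ r₃ : ℂ} (h₁ : c₁ < p) (h₂ : p < c₂) {U : Set ℂ}
    (hU : ∀ s : ℂ, c₁ ≤ s.re → s.re ≤ c₂ → s ∈ U) (hK : DifferentiableOn ℂ K U)
    (hF : ∀ s ∈ U, s ≠ p → f s * y ^ (-s) =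
      r₁ * (s - p)⁻¹ + r₂ * ((s - p) ^ 2)⁻¹ + r₃ * ((s - p) ^ 3)⁻¹ + K s)
    (hc₁ : Continuous fun t : ℝ => f (c₁ + t * I)) (hc₂ : Continuous fun t : ℝ => f (c₂ + t * I))
    (hy : y ≠ 0) (hκ : κ + |y.arg| < 0) :
    mellinLine f c₂ y - mellinLine f c₁ y = r₁ := by
  obtain ⟨C, hC⟩ := hf c₁ c₂ 1 one_pos
  have hcont : Continuous fun x : ℝ => ‖y‖ ^ (-x) :=
    continuous_const.rpow continuous_neg fun _ => Or.inl (norm_ne_zero_iff.2 hy)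
  obtain ⟨D, hD⟩ := (isCompact_Icc (a := c₁) (b := c₂)).exists_bound_of_continuousOn
    hcont.continuousOn
  have key := integral_vertical_sub_eq_residue (F := fun s => f s * y ^ (-s)) (g := fun T =>
    C * D * Real.exp ((κ + |y.arg|) * T)) h₁ h₂ hU hK hF
    (hf.integrable_mul_cpow hc₁ hy hκ) (hf.integrable_mul_cpow hc₂ hy hκ) ?_ ?_
  · rw [mellinLine, mellinLine, ← mul_sub, key, mul_assoc, ← mul_assoc]
    have : (2 * Real.pi : ℂ) ≠ 0 := by simp [Real.pi_ne_zero]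
    field_simp
  · have : Tendsto (fun T : ℝ => (κ + |y.arg|) * T) atTop atBot :=
      tendsto_id.const_mul_atTop_of_neg hκ
    simpa using (Real.tendsto_exp_atBot.comp this).const_mul (C * D)
  · intro x hx T hT
    have h := norm_cpow_neg_le hy le_rfl (x + T * I)
    have hc := hC (x + T * I) (by simpa using hx.1) (by simpa using hx.2) (by simpa using hT)
    simp only [add_re, ofReal_re, mul_re, I_re, mul_zero, ofReal_im, I_im, mul_one, sub_self,
      add_zero, add_im, mul_im, zero_add] at h hc
    have hd := (le_abs_self _).trans (hD x hx)
    have hC0 := (norm_nonneg _).trans hc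
    rw [norm_mul, add_mul, Real.exp_add]
    calc _ ≤ (C * Real.exp (κ * |T|)) * (D * Real.exp (|y.arg| * |T|)) := by
          gcongr
          exact h.trans (by gcongr)
      _ = _ := by ring

end MellinLine

/-! ### The Lambert series as a Mellin–Barnes integral -/

section LambertInversion

open Complex MeasureTheory Set

lemma continuous_Gamma_vertical {c : ℝ} (hc : 0 < c) :
    Continuous fun t : ℝ => Gamma (c + t * I) := by
  refine continuous_iff_continuousAt.2 fun t => ?_
  refine ContinuousAt.comp (f := fun t : ℝ => (c + t * I : ℂ)) (g := Gamma) ?_ (by fun_prop)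
  refine (differentiableAt_Gamma _ fun m h => ?_).continuousAt
  have := congrArg re h
  simp at this
  have : (0 : ℝ) ≤ m := m.cast_nonneg
  linarith

lemma exists_decay_exponent {θ : ℝ} (hθ : θ < Real.pi / 2) :
    ∃ κ : ℝ, -(Real.pi / 2) < κ ∧ κ + θ < 0 :=
  ⟨-(Real.pi / 2 + θ) / 2, by linarith, by linarith⟩

lemma abs_arg_lt_of_re_pos {y : ℂ} (hy : 0 < y.re) : |y.arg| < Real.pi / 2 :=
  abs_arg_lt_pi_div_two_iff.2 (Or.inl hy)

lemma integrable_Gamma_mul_cpow {y : ℂ} (hy : 0 < y.re) {c : ℝ} (hc : 0 < c) :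
    Integrable fun t : ℝ => Gamma (c + t * I) * y ^ (-(c + t * I : ℂ)) := by
  obtain ⟨κ, hκ, hκy⟩ := exists_decay_exponent (abs_arg_lt_of_re_pos hy)
  exact (verticalExpBound_Gamma hκ).integrable_mul_cpow (continuous_Gamma_vertical hc)
    (fun h => by simp [h] at hy) hκy

/-- The Cahen–Mellin integral. -/
theorem integral_cpow_mul_Gamma_mul_cpow {y : ℂ} (hy : 0 < y.re) {c : ℝ} (hc : 0 < c) {x : ℝ}
    (hx : 0 < x) :
    (2 * Real.pi : ℂ)⁻¹ * ∫ t : ℝ, (x : ℂ) ^ (-(c + t * I : ℂ)) *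
      (Gamma (c + t * I) * y ^ (-(c + t * I : ℂ))) = cexp (-y * x) := by
  have hmellin (s : ℂ) (hs : 0 < s.re) :
      mellin (fun t : ℝ => cexp (-y * t)) s = Gamma s * y ^ (-s) := by
    rw [mellin, mul_comm, ← integral_cpow_mul_exp_neg_mul_of_re_pos hs hy]
    rfl
  have hre (t : ℝ) : 0 < (c + t * I : ℂ).re := by simpa using hc
  have hconv : MellinConvergent (fun t : ℝ => cexp (-y * t)) c :=
    integrableOn_cpow_mul_exp_neg_mul (s := c) (by simpa using hc) hy
  have hvert : VerticalIntegrable (mellin fun t : ℝ => cexp (-y * t)) c := by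
    refine (integrable_Gamma_mul_cpow hy hc).congr (Eventually.of_forall fun t => ?_)
    exact (hmellin _ (hre t)).symm
  have := mellinInv_mellin_eq c (fun t : ℝ => cexp (-y * t)) hx hconv hvert (by fun_prop)
  rw [← this, mellinInv, real_smul]
  simp only [hmellin _ (hre _), smul_eq_mul]
  push_cast
  rw [one_div]

lemma hasSum_log_mul_natCast_succ_cpow {s : ℂ} (hs : 1 < s.re) :
    HasSum (fun n : ℕ => (Real.log (n + 1 : ℕ) : ℂ) * ((n + 1 : ℕ) : ℂ) ^ (-s))
      (-deriv riemannZeta s) := by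
  have habs : LSeries.abscissaOfAbsConv 1 < s.re := by
    rw [LSeries.abscissaOfAbsConv_one]; exact_mod_cast hs
  have hd : deriv riemannZeta s = -LSeries (LSeries.logMul 1) s := by
    rw [← LSeries_deriv habs]
    refine EventuallyEq.deriv_eq ?_
    filter_upwards [(isOpen_lt continuous_const continuous_re).mem_nhds hs] with z hz
    exact (LSeries_one_eq_riemannZeta hz).symm
  have h := (LSeriesSummable_logMul_of_lt_re habs).LSeriesHasSum
  rw [LSeriesHasSum, ← hasSum_nat_add_iff' 1] at h
  rw [hd, neg_neg]
  simp only [natCast_log]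
  simpa [LSeries.term, LSeries.logMul, cpow_neg, div_eq_mul_inv] using h

lemma hasSum_exp_neg_succ_mul {z : ℂ} (hz : 0 < z.re) :
    HasSum (fun m : ℕ => cexp (-z * (m + 1 : ℕ))) (1 / (cexp z - 1)) := by
  have hn : ‖cexp (-z)‖ < 1 := by rw [norm_exp, neg_re]; simpa using hz
  have h := (hasSum_geometric_of_norm_lt_one hn).mul_left (cexp (-z))
  have hne : 1 - cexp (-z) ≠ 0 := fun h0 => by
    rw [← sub_eq_zero.1 h0, norm_one] at hn
    exact lt_irrefl _ hn
  have hfun : (fun m : ℕ => cexp (-z * (m + 1 : ℕ))) = fun m => cexp (-z) * cexp (-z) ^ m := by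
    ext m
    rw [← Complex.exp_nat_mul, ← Complex.exp_add]
    congr 1
    push_cast
    ring
  have hval : 1 / (cexp z - 1) = cexp (-z) * (1 - cexp (-z))⁻¹ := by
    have hne' : cexp z - 1 ≠ 0 := fun h0 => hne (by
      rw [Complex.exp_neg, sub_eq_zero.1 h0, inv_one, sub_self])
    rw [← div_eq_mul_inv, div_eq_div_iff hne' hne, one_mul, mul_sub, ← Complex.exp_add]
    simp
  rw [hfun, hval]
  exact h

/-- The Lambert series of the logarithm is the Mellin–Barnes integral of `Γ(s) ζ(s) (-ζ'(s))`. -/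
theorem hasSum_lambertLogTerm {y : ℂ} (hy : 0 < y.re) :
    HasSum (fun n : ℕ => lambertLogTerm y (n + 1)) (mellinLine lambertMellin 3 y) := by
  set G : ℝ → ℂ := fun t => Gamma ((3 : ℝ) + t * I) * y ^ (-((3 : ℝ) + t * I : ℂ)) with hG
  have hGi : Integrable G := integrable_Gamma_mul_cpow hy (by norm_num)
  set a : ℕ → ℂ → ℂ := fun n s => (Real.log (n + 1 : ℕ) : ℂ) * ((n + 1 : ℕ) : ℂ) ^ (-s)
  set b : ℕ → ℂ → ℂ := fun m s => ((m + 1 : ℕ) : ℂ) ^ (-s)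
  set F : ℕ × ℕ → ℝ → ℂ := fun p t =>
    a p.1 ((3 : ℝ) + t * I) * b p.2 ((3 : ℝ) + t * I) * G t with hF
  have h3 (t : ℝ) : 1 < ((3 : ℝ) + t * I : ℂ).re := by simp
  have ha (t : ℝ) := hasSum_log_mul_natCast_succ_cpow (h3 t)
  have hb (t : ℝ) := hasSum_natCast_succ_cpow (h3 t)
  -- The norms of the coefficients do not depend on `t`; this reduces the Fubini hypothesis to the
  -- absolute convergence of the two Dirichlet series at `s = 3`.
  have hnb (m : ℕ) (t : ℝ) : ‖b m ((3 : ℝ) + t * I)‖ = ‖b m ((3 : ℝ) + (0 : ℝ) * I)‖ := by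
    simp only [b]
    rw [norm_natCast_cpow_of_pos m.succ_pos, norm_natCast_cpow_of_pos m.succ_pos]
    simp
  have hna (n : ℕ) (t : ℝ) : ‖a n ((3 : ℝ) + t * I)‖ = ‖a n ((3 : ℝ) + (0 : ℝ) * I)‖ := by
    simp only [a]
    rw [norm_mul, norm_mul]
    congr 1
    exact hnb n t
  have hFeq (p : ℕ × ℕ) (t : ℝ) : F p t = (Real.log (p.1 + 1 : ℕ) : ℂ) *
      ((((p.1 + 1 : ℕ) : ℝ) * ((p.2 + 1 : ℕ) : ℝ) : ℝ) ^ (-((3 : ℝ) + t * I : ℂ)) * G t) := by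
    simp only [hF, a, b]
    rw [ofReal_mul, mul_cpow_ofReal_nonneg (by positivity) (by positivity)]
    push_cast
    ring
  have hFc (p : ℕ × ℕ) : Integrable (F p) := by
    have hm : AEStronglyMeasurable
        (fun t : ℝ => a p.1 ((3 : ℝ) + t * I) * b p.2 ((3 : ℝ) + t * I)) volume := by
      refine Continuous.aestronglyMeasurable ?_
      simp only [a, b]
      refine (continuous_const.mul ?_).mul ?_ <;>
        exact Continuous.const_cpow (by fun_prop) (Or.inl (Nat.cast_ne_zero.2 (Nat.succ_ne_zero _)))
    refine hGi.bdd_mul (c := ‖a p.1 ((3 : ℝ) + (0 : ℝ) * I)‖ * ‖b p.2 ((3 : ℝ) + (0 : ℝ) * I)‖) hm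
      (Eventually.of_forall fun t => ?_)
    rw [norm_mul, hna, hnb]
  have hsumnorm : Summable fun p : ℕ × ℕ => ∫ t, ‖F p t‖ := by
    have hs : Summable fun p : ℕ × ℕ => ‖a p.1 ((3 : ℝ) + (0 : ℝ) * I)‖ *
        ‖b p.2 ((3 : ℝ) + (0 : ℝ) * I)‖ * ∫ t, ‖G t‖ :=
      (Summable.mul_of_nonneg (ha 0).summable.norm (hb 0).summable.norm
        (fun _ => norm_nonneg _) (fun _ => norm_nonneg _)).mul_right (∫ t, ‖G t‖)
    refine hs.congr fun p => ?_
    rw [← integral_const_mul]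
    refine integral_congr_ae (Eventually.of_forall fun t => ?_)
    beta_reduce
    rw [hF, norm_mul (_ * _), norm_mul (a _ _), hna p.1 t, hnb p.2 t]
  have hint := (hasSum_integral_of_summable_integral_norm hFc hsumnorm).mul_left
    (2 * Real.pi : ℂ)⁻¹
  have htsum (t : ℝ) : ∑' p, F p t =
      lambertMellin ((3 : ℝ) + t * I) * y ^ (-((3 : ℝ) + t * I : ℂ)) := by
    simp only [hF]
    rw [tsum_mul_right, ← tsum_mul_tsum_of_summable_norm (ha t).summable.norm (hb t).summable.norm,
      (ha t).tsum_eq, (hb t).tsum_eq]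
    simp only [hG, lambertMellin]
    ring
  simp only [htsum] at hint
  rw [mellinLine]
  refine HasSum.prod_fiberwise (f := fun p : ℕ × ℕ => (2 * Real.pi : ℂ)⁻¹ * ∫ t, F p t) hint
    fun n => ?_
  have hterm (m : ℕ) : (2 * Real.pi : ℂ)⁻¹ * ∫ t, F (n, m) t =
      (Real.log (n + 1 : ℕ) : ℂ) * cexp (-((n + 1 : ℕ) * y) * (m + 1 : ℕ)) := by
    simp only [hFeq]
    rw [integral_const_mul, mul_left_comm, integral_cpow_mul_Gamma_mul_cpow hy (by norm_num)
      (by positivity)]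
    congr 2
    push_cast
    ring
  simp only [hterm]
  have hre : 0 < (((n + 1 : ℕ) : ℂ) * y).re := by
    rw [← ofReal_natCast, re_ofReal_mul]
    positivity
  have := (hasSum_exp_neg_succ_mul hre).mul_left (Real.log (n + 1 : ℕ) : ℂ)
  simpa [lambertLogTerm, div_eq_mul_inv] using this

end LambertInversion

/-! ### The triple pole at `s = 1` -/

section Taylor

open Complex Set

/-- On `U`, the function `f` is `a + b (s - p) + c (s - p)² + (s - p)³ K(s)` with `K`
holomorphic. -/
def HasTaylorTwo (f : ℂ → ℂ) (U : Set ℂ) (p a b c : ℂ) : Prop :=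
  ∃ K : ℂ → ℂ, DifferentiableOn ℂ K U ∧
    ∀ s ∈ U, f s = a + b * (s - p) + c * (s - p) ^ 2 + (s - p) ^ 3 * K s

lemma HasTaylorTwo.mul {f g : ℂ → ℂ} {U : Set ℂ} {p a b c a' b' c' : ℂ}
    (hf : HasTaylorTwo f U p a b c) (hg : HasTaylorTwo g U p a' b' c') :
    HasTaylorTwo (fun s => f s * g s) U p (a * a') (a * b' + b * a')
      (a * c' + b * b' + c * a') := by
  obtain ⟨K, hK, hf⟩ := hf
  obtain ⟨L, hL, hg⟩ := hg
  refine ⟨fun s => b * c' + c * b' + c * c' * (s - p) + K s * (a' + b' * (s - p) + c' * (s - p) ^ 2)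
    + L s * (a + b * (s - p) + c * (s - p) ^ 2) + (s - p) ^ 3 * K s * L s, ?_, fun s hs => ?_⟩
  · fun_prop
  · beta_reduce
    rw [hf s hs, hg s hs]
    ring

lemma exists_hasTaylorTwo {f : ℂ → ℂ} {U : Set ℂ} (hU : IsOpen U) (hf : DifferentiableOn ℂ f U)
    {p : ℂ} (hp : p ∈ U) : ∃ c, HasTaylorTwo f U p (f p) (deriv f p) c := by
  have hn := hU.mem_nhds hp
  set g := dslope f p
  set h := dslope g p
  have hg : DifferentiableOn ℂ g U := (Complex.differentiableOn_dslope hn).2 hf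
  have hh : DifferentiableOn ℂ h U := (Complex.differentiableOn_dslope hn).2 hg
  refine ⟨h p, dslope h p, (Complex.differentiableOn_dslope hn).2 hh, fun s _ => ?_⟩
  have h1 : (s - p) * g s = f s - f p := sub_smul_dslope f p s
  have h2 : (s - p) * h s = g s - g p := sub_smul_dslope g p s
  have h3 : (s - p) * dslope h p s = h s - h p := sub_smul_dslope h p s
  have h4 : g p = deriv f p := dslope_same f p
  rw [← h4]
  linear_combination (-1) * h1 + (-(s - p)) * h2 + (-(s - p) ^ 2) * h3

lemma HasTaylorTwo.exists_deriv_eq {f : ℂ → ℂ} {U : Set ℂ} (hU : IsOpen U) {p a b c : ℂ}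
    (hf : HasTaylorTwo f U p a b c) : ∃ M : ℂ → ℂ, DifferentiableOn ℂ M U ∧
      ∀ s ∈ U, deriv f s = b + 2 * c * (s - p) + (s - p) ^ 2 * M s := by
  obtain ⟨K, hK, hf⟩ := hf
  have hK' := hK.deriv hU
  refine ⟨fun s => 3 * K s + (s - p) * deriv K s, by fun_prop, fun s hs => ?_⟩
  have hn := hU.mem_nhds hs
  have h1 : HasDerivAt (fun s : ℂ => s - p) 1 s := (hasDerivAt_id s).sub_const p
  have h2 : HasDerivAt (fun s : ℂ => (s - p) ^ 2) (2 * (s - p)) s := by simpa using h1.fun_pow 2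
  have h3 : HasDerivAt (fun s : ℂ => (s - p) ^ 3) (3 * (s - p) ^ 2) s := by
    simpa using h1.fun_pow 3
  have h := (((h1.const_mul b).const_add a).add (h2.const_mul c)).add
    (h3.mul (hK.differentiableAt hn).hasDerivAt)
  rw [((Set.EqOn.eventuallyEq_of_mem hf hn).deriv_eq.trans h.deriv)]
  ring

lemma HasTaylorTwo.deriv_deriv {f : ℂ → ℂ} {U : Set ℂ} (hU : IsOpen U) {p a b c : ℂ} (hp : p ∈ U)
    (hf : HasTaylorTwo f U p a b c) : deriv (deriv f) p = 2 * c := by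
  obtain ⟨M, hM, h⟩ := hf.exists_deriv_eq hU
  have hn := hU.mem_nhds hp
  have h1 : HasDerivAt (fun s : ℂ => s - p) 1 p := (hasDerivAt_id p).sub_const p
  have h2 := ((h1.const_mul (2 * c)).const_add b).add
    ((h1.fun_pow 2).mul (hM.differentiableAt hn).hasDerivAt)
  rw [(Set.EqOn.eventuallyEq_of_mem h hn).deriv_eq.trans h2.deriv]
  simp

/-- The second-order Taylor coefficient is determined as a limit along real increments. -/
lemma HasTaylorTwo.tendsto {f : ℂ → ℂ} {U : Set ℂ} (hU : IsOpen U) {p a b c : ℂ} (hp : p ∈ U)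
    (hf : HasTaylorTwo f U p a b c) :
    Tendsto (fun u : ℂ => (f (p + u) - a - b * u) / u ^ 2) (𝓝[≠] 0) (𝓝 c) := by
  obtain ⟨K, hK, hf⟩ := hf
  have hKc : ContinuousAt (fun u : ℂ => K (p + u)) 0 := by
    refine ContinuousAt.comp (f := fun u : ℂ => p + u) (g := K) ?_ (by fun_prop)
    rw [add_zero]
    exact (hK.differentiableAt (hU.mem_nhds hp)).continuousAt
  have h1 : Tendsto (fun u : ℂ => c + u * K (p + u)) (𝓝[≠] 0) (𝓝 c) := by
    have : ContinuousAt (fun u : ℂ => c + u * K (p + u)) 0 :=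
      continuousAt_const.add (continuousAt_id.mul hKc)
    simpa using this.tendsto.mono_left nhdsWithin_le_nhds
  refine h1.congr' ?_
  have hmem : ∀ᶠ u : ℂ in 𝓝 0, p + u ∈ U :=
    (by fun_prop : ContinuousAt (fun u : ℂ => p + u) 0).eventually_mem
      (by rw [add_zero]; exact hU.mem_nhds hp)
  filter_upwards [nhdsWithin_le_nhds hmem, self_mem_nhdsWithin] with u hu hu0
  have hu0 : u ≠ 0 := hu0
  rw [hf _ hu, add_sub_cancel_left]
  field_simp
  ring

lemma tendsto_sin_div_self : Tendsto (fun u : ℂ => Complex.sin (Real.pi * u) / u) (𝓝[≠] 0)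
    (𝓝 Real.pi) := by
  have h : HasDerivAt (fun u : ℂ => Complex.sin (Real.pi * u)) Real.pi 0 := by
    simpa using ((hasDerivAt_id (0 : ℂ)).const_mul (Real.pi : ℂ)).csin
  simpa [div_eq_inv_mul] using h.tendsto_slope_zero

lemma tendsto_self_sub_sin_div_cube :
    Tendsto (fun u : ℂ => (Real.pi * u - Complex.sin (Real.pi * u)) / u ^ 3) (𝓝[≠] 0)
      (𝓝 ((Real.pi : ℂ) ^ 3 / 6)) := by
  rw [tendsto_iff_norm_sub_tendsto_zero]
  have hz : Tendsto (fun u : ℂ => Real.pi ^ 5 / 100 * ‖u‖ ^ 2) (𝓝[≠] 0) (𝓝 0) := by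
    have : Continuous fun u : ℂ => Real.pi ^ 5 / 100 * ‖u‖ ^ 2 := by fun_prop
    simpa using (this.tendsto 0).mono_left nhdsWithin_le_nhds
  refine squeeze_zero' (Eventually.of_forall fun _ => norm_nonneg _) ?_ hz
  have hsmall : ∀ᶠ u : ℂ in 𝓝 0, ‖(Real.pi : ℂ) * u‖ ≤ 1 := by
    have : Tendsto (fun u : ℂ => ‖(Real.pi : ℂ) * u‖) (𝓝 0) (𝓝 0) := by
      have : Continuous fun u : ℂ => ‖(Real.pi : ℂ) * u‖ := by fun_prop
      simpa using this.tendsto 0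
    exact (this.eventually_lt_const one_pos).mono fun _ h => h.le
  filter_upwards [nhdsWithin_le_nhds hsmall, self_mem_nhdsWithin] with u hu hu0
  have hu0 : u ≠ 0 := hu0
  have h := Complex.sin_bound hu
  have heq : (Real.pi * u - Complex.sin (Real.pi * u)) / u ^ 3 - (Real.pi : ℂ) ^ 3 / 6 =
      -(Complex.sin (Real.pi * u) - (Real.pi * u - (Real.pi * u) ^ 3 / 6)) / u ^ 3 := by
    field_simp
    ring
  rw [heq, norm_div, norm_neg, norm_pow, div_le_iff₀ (by positivity)]
  refine h.trans (le_of_eq ?_)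
  rw [norm_mul, norm_real, Real.norm_of_nonneg Real.pi_pos.le]
  ring

lemma isOpen_re_pos : IsOpen {s : ℂ | 0 < s.re} := isOpen_lt continuous_const continuous_re

/-- The second-order expansion of `Γ` at `1`. The quadratic coefficient comes from the reflection
formula `Γ(1 + u) Γ(1 - u) = π u / sin (π u)`. -/
theorem hasTaylorTwo_Gamma : HasTaylorTwo Gamma {s | 0 < s.re} 1 1
    (-Real.eulerMascheroniConstant)
    ((Real.eulerMascheroniConstant : ℂ) ^ 2 / 2 + (Real.pi : ℂ) ^ 2 / 12) := by
  set γ : ℂ := (Real.eulerMascheroniConstant : ℂ)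
  have hU := isOpen_re_pos
  have hp : (1 : ℂ) ∈ {s : ℂ | 0 < s.re} := by simp
  have hd : DifferentiableOn ℂ Gamma {s | 0 < s.re} := fun s hs =>
    (differentiableAt_Gamma s fun m h => by
      have hs : 0 < s.re := hs
      have := congrArg re h
      simp at this
      have : (0 : ℝ) ≤ m := m.cast_nonneg
      linarith).differentiableWithinAt
  obtain ⟨c, hc⟩ := exists_hasTaylorTwo hU hd hp
  rw [Gamma_one, hasDerivAt_Gamma_one.deriv] at hc
  suffices h : c = γ ^ 2 / 2 + (Real.pi : ℂ) ^ 2 / 12 by rwa [h] at hc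
  have h1 := hc.tendsto hU hp
  have hneg : Tendsto (fun u : ℂ => -u) (𝓝[≠] 0) (𝓝[≠] 0) := by
    refine tendsto_nhdsWithin_iff.2 ⟨?_, ?_⟩
    · simpa using (continuous_neg.tendsto (0 : ℂ)).mono_left nhdsWithin_le_nhds
    · filter_upwards [self_mem_nhdsWithin] with u hu
      simpa using hu
  have h2 := h1.comp hneg
  have hΓ : Tendsto (fun u : ℂ => Gamma (1 + u)) (𝓝[≠] 0) (𝓝 1) := by
    have : ContinuousAt (fun u : ℂ => Gamma (1 + u)) 0 := by
      refine ContinuousAt.comp (f := fun u : ℂ => 1 + u) (g := Gamma) ?_ (by fun_prop)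
      rw [add_zero]
      exact (hd.differentiableAt (hU.mem_nhds hp)).continuousAt
    simpa using this.tendsto.mono_left nhdsWithin_le_nhds
  have hu : Tendsto (fun u : ℂ => u) (𝓝[≠] 0) (𝓝 0) := nhdsWithin_le_nhds
  -- `(Γ(1 + u) Γ(1 - u) - 1) / u²` tends to `2 c - γ²` ...
  have hq : Tendsto (fun u : ℂ => (Gamma (1 + u) * Gamma (1 - u) - 1) / u ^ 2) (𝓝[≠] 0)
      (𝓝 (2 * c - γ ^ 2)) := by
    have h3 := (h1.add ((hΓ.mul h2))).add
      ((((h1.mul hu).const_mul γ)).add (tendsto_const_nhds (x := -γ ^ 2)))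
    have hval : c + 1 * c + (γ * (c * 0) + -γ ^ 2) = 2 * c - γ ^ 2 := by ring
    rw [hval] at h3
    refine h3.congr' ?_
    filter_upwards [self_mem_nhdsWithin] with u hu0
    have hu0 : u ≠ 0 := hu0
    simp only [Function.comp_apply, ← sub_eq_add_neg]
    field_simp
    ring
  -- ... and the reflection formula gives `π` times this limit as that of `(π u - sin (π u)) / u³`.
  have hr := (hq.mul tendsto_sin_div_self)
  have hrefl : ∀ᶠ u : ℂ in 𝓝[≠] 0, (Gamma (1 + u) * Gamma (1 - u) - 1) / u ^ 2 *
      (Complex.sin (Real.pi * u) / u) = (Real.pi * u - Complex.sin (Real.pi * u)) / u ^ 3 := by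
    have hsin := tendsto_sin_div_self.eventually_ne
      (show (Real.pi : ℂ) ≠ 0 from ofReal_ne_zero.2 Real.pi_ne_zero)
    filter_upwards [self_mem_nhdsWithin, hsin] with u hu0 hs
    have hu0 : u ≠ 0 := hu0
    have hs0 : Complex.sin (Real.pi * u) ≠ 0 := fun h => hs (by rw [h, zero_div])
    have h := Gamma_mul_Gamma_one_sub u
    rw [eq_div_iff hs0] at h
    rw [add_comm 1 u, Gamma_add_one u hu0]
    generalize Complex.sin (Real.pi * u) = S at h hs0 ⊢
    field_simp
    linear_combination u * h
  have hlim := tendsto_nhds_unique (hr.congr' hrefl) tendsto_self_sub_sin_div_cube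
  have hpi : (Real.pi : ℂ) ≠ 0 := ofReal_ne_zero.2 Real.pi_ne_zero
  have : 2 * c - γ ^ 2 = (Real.pi : ℂ) ^ 2 / 6 := by
    refine mul_right_cancel₀ hpi ?_
    rw [hlim]
    ring
  linear_combination this / 2

lemma hasTaylorTwo_cpow_neg {y : ℂ} (hy : y ≠ 0) :
    HasTaylorTwo (fun s => y ^ (-s)) {s | 0 < s.re} 1 y⁻¹ (-(y⁻¹ * Complex.log y))
      (y⁻¹ * (Complex.log y ^ 2 / 2)) := by
  have hU := isOpen_re_pos
  have hp : (1 : ℂ) ∈ {s : ℂ | 0 < s.re} := by simp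
  have hder (s : ℂ) : HasDerivAt (fun s : ℂ => y ^ (-s)) (-(y ^ (-s) * Complex.log y)) s := by
    simpa using (hasDerivAt_neg s).const_cpow (c := y) (Or.inl hy)
  obtain ⟨c, hc⟩ := exists_hasTaylorTwo hU
    (fun s _ => (hder s).differentiableAt.differentiableWithinAt) hp
  rw [(hder 1).deriv, cpow_neg_one] at hc
  have h2 := hc.deriv_deriv hU hp
  rw [show deriv (fun s : ℂ => y ^ (-s)) = fun s => -(y ^ (-s) * Complex.log y) from
    funext fun s => (hder s).deriv, ((hder 1).mul_const (Complex.log y)).fun_neg.deriv,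
    cpow_neg_one] at h2
  rwa [show c = y⁻¹ * (Complex.log y ^ 2 / 2) by linear_combination (-1 / 2) * h2] at hc

lemma hasTaylorTwo_riemannZeta₁_mul :
    HasTaylorTwo (fun s => riemannZeta₁ s * (riemannZeta₁ s - (s - 1) * deriv riemannZeta₁ s))
      {s | 0 < s.re} 1 1 Real.eulerMascheroniConstant 0 := by
  have hp : (1 : ℂ) ∈ {s : ℂ | 0 < s.re} := by simp
  obtain ⟨δ, hδ⟩ := exists_hasTaylorTwo isOpen_re_pos
    differentiable_riemannZeta₁.differentiableOn hp
  rw [riemannZeta₁_one, deriv_riemannZeta₁_one] at hδ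
  obtain ⟨M, hM, hd⟩ := hδ.exists_deriv_eq isOpen_re_pos
  have h2 : HasTaylorTwo (fun s => riemannZeta₁ s - (s - 1) * deriv riemannZeta₁ s)
      {s | 0 < s.re} 1 1 0 (-δ) := by
    obtain ⟨K, hK, hf⟩ := hδ
    refine ⟨fun s => K s - M s, hK.sub hM, fun s hs => ?_⟩
    beta_reduce
    rw [hf s hs, hd s hs]
    ring
  have := hδ.mul h2
  convert this using 1 <;> ring

/-- The triple pole of `Γ(s) ζ(s) (-ζ'(s)) y⁻ˢ` at `s = 1`, with its residue. The quadratic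
coefficients of `ζ` cancel, so that no Stieltjes constant appears. -/
theorem exists_principalPart_one {y : ℂ} (hy : y ≠ 0) :
    ∃ (K : ℂ → ℂ) (r₂ r₃ : ℂ), DifferentiableOn ℂ K {s | 0 < s.re} ∧
      ∀ s ∈ {s : ℂ | 0 < s.re}, s ≠ (1 : ℝ) → lambertMellin s * y ^ (-s) =
        (1 / (2 * y) * Complex.log y ^ 2 + 1 / y * ((Real.pi : ℂ) ^ 2 / 12 -
          (Real.eulerMascheroniConstant : ℂ) ^ 2 / 2)) * (s - (1 : ℝ))⁻¹ +
        r₂ * ((s - (1 : ℝ)) ^ 2)⁻¹ + r₃ * ((s - (1 : ℝ)) ^ 3)⁻¹ + K s := by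
  obtain ⟨K, hK, h⟩ := (hasTaylorTwo_Gamma.mul hasTaylorTwo_riemannZeta₁_mul).mul
    (hasTaylorTwo_cpow_neg hy)
  refine ⟨K, -(y⁻¹ * Complex.log y), y⁻¹, hK, fun s hs h1 => ?_⟩
  rw [ofReal_one] at h1 ⊢
  have h1' : s - 1 ≠ 0 := sub_ne_zero.2 h1
  have hF : lambertMellin s * y ^ (-s) = (Gamma s * (riemannZeta₁ s * (riemannZeta₁ s -
      (s - 1) * deriv riemannZeta₁ s)) * y ^ (-s)) * ((s - 1) ^ 3)⁻¹ := by
    rw [lambertMellin, riemannZeta_eq_inv_sub_mul h1,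
      deriv_riemannZeta_eq_neg_inv_sub_sq_mul_add h1]
    field_simp
    ring
  have hs' := h s hs
  beta_reduce at hs'
  rw [hF, hs']
  field_simp
  ring

end Taylor

/-! ### The simple poles at the non-positive integers -/

section Residues

open Complex Set

lemma prod_add_natCast_mul_Gamma {s : ℂ} (n : ℕ) (hs : ∀ i < n, s + i ≠ 0) :
    (∏ i ∈ Finset.range n, (s + i)) * Gamma s = Gamma (s + n) := by
  induction n with
  | zero => simp
  | succ n ih =>
    rw [Finset.prod_range_succ, mul_right_comm, ih fun i hi => hs i (by omega), Nat.cast_succ,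
      ← add_assoc, Gamma_add_one _ (hs n (by omega)), mul_comm]

lemma prod_range_neg_add_natCast (j : ℕ) :
    ∏ i ∈ Finset.range j, (-(j : ℂ) + i) = (-1) ^ j * (j.factorial : ℂ) := by
  rw [← Finset.prod_range_reflect, ← Finset.prod_range_add_one_eq_factorial, Nat.cast_prod]
  rw [← Finset.card_range j, ← Finset.prod_const, Finset.card_range, ← Finset.prod_mul_distrib]
  refine Finset.prod_congr rfl fun i hi => ?_
  have hi := Finset.mem_range.1 hi
  rw [Nat.cast_sub (by omega), Nat.cast_sub (by omega)]
  push_cast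
  ring

/-- The residue of `Γ(s) ζ(s) (-ζ'(s))` at `s = -j`. -/
noncomputable def lambertResidue (j : ℕ) : ℂ :=
  (-1) ^ j / (j.factorial : ℂ) * (riemannZeta (-j) * -deriv riemannZeta (-j))

lemma continuous_lambertMellin_vertical {c : ℝ} (h1 : c ≠ 1) (hc : ∀ n : ℕ, c ≠ -n) :
    Continuous fun t : ℝ => lambertMellin (c + t * I) := by
  refine continuous_iff_continuousAt.2 fun t => ?_
  refine ContinuousAt.comp (f := fun t : ℝ => (c + t * I : ℂ)) (g := lambertMellin) ?_
    (by fun_prop)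
  refine (differentiableAt_lambertMellin (fun h => h1 ?_) fun n h => hc n ?_).continuousAt
  · simpa using congrArg re h
  · simpa using congrArg re h

lemma continuous_lambertMellin_half_sub (n : ℕ) :
    Continuous fun t : ℝ => lambertMellin ((1 / 2 - n : ℝ) + t * I) := by
  refine continuous_lambertMellin_vertical (fun h => ?_) fun m h => ?_
  · have : (0 : ℝ) ≤ n := n.cast_nonneg
    linarith
  · have : ((2 * m + 1 : ℕ) : ℝ) = (2 * n : ℕ) := by push_cast; linarith
    have := Nat.cast_injective this
    omega

/-- Crossing the simple pole at `s = -j`. -/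
theorem mellinLine_sub_eq_lambertResidue (j : ℕ) {y : ℂ} (hy : 0 < y.re) :
    mellinLine lambertMellin (1 / 2 - j) y - mellinLine lambertMellin (1 / 2 - (j + 1 : ℕ)) y =
      lambertResidue j * y ^ j := by
  have hy0 : y ≠ 0 := fun h => by simp [h] at hy
  obtain ⟨κ, hκ, hκy⟩ := exists_decay_exponent (abs_arg_lt_of_re_pos hy)
  set U : Set ℂ := {s | -(j : ℝ) - 1 < s.re} ∩ {s | s.re < -(j : ℝ) + 1} with hUdef
  have hU : IsOpen U := (isOpen_lt continuous_const continuous_re).inter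
    (isOpen_lt continuous_re continuous_const)
  have hjU : (-j : ℂ) ∈ U := by constructor <;> simp
  have hfac (s : ℂ) (hs : s ∈ U) (i : ℕ) (hi : i < j) : s + i ≠ 0 := fun h => by
    have h2 : s.re < -(j : ℝ) + 1 := hs.2
    have := congrArg re h
    simp at this
    have : (i + 1 : ℝ) ≤ j := by exact_mod_cast hi
    linarith
  have hprod (s : ℂ) (hs : s ∈ U) : ∏ i ∈ Finset.range j, (s + i) ≠ 0 :=
    Finset.prod_ne_zero_iff.2 fun i hi => hfac s hs i (Finset.mem_range.1 hi)
  have h1U (s : ℂ) (hs : s ∈ U) : s ≠ 1 := fun h => by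
    have h2 : s.re < -(j : ℝ) + 1 := hs.2
    have : (0 : ℝ) ≤ j := j.cast_nonneg
    rw [h, one_re] at h2
    linarith
  -- `Φ(s) = (s + j) Γ(s) ζ(s) (-ζ'(s)) y⁻ˢ` extended holomorphically to `s = -j`.
  set Φ : ℂ → ℂ := fun s => Gamma (s + (j + 1 : ℕ)) * (∏ i ∈ Finset.range j, (s + i))⁻¹ *
    (riemannZeta s * -deriv riemannZeta s) * y ^ (-s) with hΦ
  have hΦd : DifferentiableOn ℂ Φ U := fun s hs => by
    refine DifferentiableAt.differentiableWithinAt ?_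
    have hG : DifferentiableAt ℂ (fun s : ℂ => Gamma (s + (j + 1 : ℕ))) s := by
      refine DifferentiableAt.comp (g := Gamma) s (differentiableAt_Gamma _ fun m h => ?_)
        (by fun_prop)
      have h2 : -(j : ℝ) - 1 < s.re := hs.1
      have := congrArg re h
      simp at this
      have : (0 : ℝ) ≤ m := m.cast_nonneg
      linarith
    have hP : DifferentiableAt ℂ (fun s : ℂ => (∏ i ∈ Finset.range j, (s + i))⁻¹) s :=
      DifferentiableAt.fun_inv (by fun_prop) (hprod s hs)
    exact ((hG.mul hP).mul ((differentiableAt_riemannZeta (h1U s hs)).mul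
      (differentiableAt_deriv_riemannZeta (h1U s hs)).neg)).mul
      (differentiableAt_id.neg.const_cpow (Or.inl hy0))
  have hΦj : Φ (-j : ℂ) = lambertResidue j * y ^ j := by
    simp only [hΦ, lambertResidue]
    rw [prod_range_neg_add_natCast, neg_neg, cpow_natCast]
    have : (-(j : ℂ) + (j + 1 : ℕ)) = 1 := by push_cast; ring
    rw [this, Gamma_one, one_mul, mul_inv, ← inv_pow, inv_neg_one]
    ring
  rw [← hΦj]
  refine (verticalExpBound_lambertMellin hκ).mellinLine_sub_eq (p := -(j : ℝ)) (r₂ := 0) (r₃ := 0)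
    (K := dslope Φ (-j : ℂ)) (by push_cast; linarith) (by linarith) (U := U) (fun s h1 h2 => ?_)
    ((Complex.differentiableOn_dslope (hU.mem_nhds hjU)).2 hΦd) (fun s hs hne => ?_)
    (continuous_lambertMellin_half_sub (j + 1)) (continuous_lambertMellin_half_sub j) hy0 hκy
  · refine ⟨?_, ?_⟩
    · have : (1 / 2 - (j + 1 : ℕ) : ℝ) ≤ s.re := h1
      push_cast at this
      show -(j : ℝ) - 1 < s.re
      linarith
    · show s.re < -(j : ℝ) + 1
      linarith
  · have hcast : ((-(j : ℝ) : ℝ) : ℂ) = -(j : ℂ) := by push_cast; ring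
    rw [hcast] at hne ⊢
    have hne' : s - -(j : ℂ) ≠ 0 := sub_ne_zero.2 hne
    have hsj : s + j ≠ 0 := by simpa using hne'
    have hΓ := prod_add_natCast_mul_Gamma (s := s) (j + 1) fun i hi => by
      rcases Nat.lt_succ_iff_lt_or_eq.1 hi with h | h
      · exact hfac s hs i h
      · rw [h]; exact hsj
    rw [Finset.prod_range_succ] at hΓ
    have hval : lambertMellin s * y ^ (-s) = Φ s * (s - -(j : ℂ))⁻¹ := by
      simp only [hΦ, lambertMellin]
      rw [← hΓ, sub_neg_eq_add]
      have := hprod s hs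
      field_simp
    rw [hval, dslope_of_ne _ hne, slope_def_field]
    field_simp
    ring

lemma mellinLine_half_eq_sum (n : ℕ) {y : ℂ} (hy : 0 < y.re) :
    mellinLine lambertMellin (1 / 2) y = ∑ j ∈ Finset.range n, lambertResidue j * y ^ j +
      mellinLine lambertMellin (1 / 2 - n) y := by
  induction n with
  | zero => simp
  | succ n ih =>
    rw [Finset.sum_range_succ, ← mellinLine_sub_eq_lambertResidue n hy, ih]
    ring

/-- Crossing the triple pole at `s = 1`. -/
theorem mellinLine_three_eq {y : ℂ} (hy : 0 < y.re) :
    mellinLine lambertMellin 3 y = 1 / (2 * y) * Complex.log y ^ 2 +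
      1 / y * ((Real.pi : ℂ) ^ 2 / 12 - (Real.eulerMascheroniConstant : ℂ) ^ 2 / 2) +
      mellinLine lambertMellin (1 / 2) y := by
  have hy0 : y ≠ 0 := fun h => by simp [h] at hy
  obtain ⟨κ, hκ, hκy⟩ := exists_decay_exponent (abs_arg_lt_of_re_pos hy)
  obtain ⟨K, r₂, r₃, hK, hF⟩ := exists_principalPart_one hy0
  refine eq_add_of_sub_eq ((verticalExpBound_lambertMellin hκ).mellinLine_sub_eq (p := 1)
    (by norm_num) (by norm_num) (fun s h1 _ => ?_) hK hF ?_ ?_ hy0 hκy)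
  · show 0 < s.re
    linarith
  · simpa using continuous_lambertMellin_half_sub 0
  · refine continuous_lambertMellin_vertical (by norm_num) fun n h => ?_
    have : (0 : ℝ) ≤ n := n.cast_nonneg
    linarith

lemma lambertResidue_zero : lambertResidue 0 = -(1 / 4 * (Real.log (2 * Real.pi) : ℂ)) := by
  rw [lambertResidue]
  simp only [Nat.cast_zero, neg_zero, riemannZeta_zero, deriv_riemannZeta_zero, pow_zero,
    Nat.factorial_zero, Nat.cast_one]
  rw [ofReal_log (by positivity)]
  push_cast
  ring

lemma lambertResidue_one :
    lambertResidue 1 = 1 / 12 * ((Real.log glaisherKinkelin : ℂ) - 1 / 12) := by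
  rw [lambertResidue, ofReal_log_glaisherKinkelin.1]
  simp only [Nat.cast_one, riemannZeta_neg_one, Nat.factorial_one]
  ring

lemma lambertResidue_even {k : ℕ} (hk : k ≠ 0) : lambertResidue (2 * k) = 0 := by
  obtain ⟨m, rfl⟩ := Nat.exists_eq_succ_of_ne_zero hk
  have := riemannZeta_neg_two_mul_nat_add_one m
  rw [lambertResidue, show (-((2 * (m + 1) : ℕ) : ℂ)) = -2 * (m + 1) by push_cast; ring, this]
  simp

/-- The derivative of the functional equation at the even integer `2 k`. -/
lemma deriv_riemannZeta_one_sub_two_mul {k : ℕ} (hk : k ≠ 0) :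
    deriv riemannZeta (1 - 2 * k) = riemannZeta (1 - 2 * k) * (Real.log (2 * Real.pi) +
      Real.eulerMascheroniConstant - harmonic (2 * k - 1)) -
      2 * (-1) ^ k * ((2 * k - 1).factorial : ℂ) * deriv riemannZeta (2 * k) /
        (2 * Real.pi) ^ (2 * k) := by
  obtain ⟨m, hm⟩ : ∃ m, 2 * k = m + 1 := ⟨2 * k - 1, by omega⟩
  have hm' : 2 * k - 1 = m := by omega
  have hs : (2 * k : ℂ) = m + 1 := by exact_mod_cast hm
  have hk1 : 1 ≤ (k : ℝ) := by exact_mod_cast Nat.one_le_iff_ne_zero.2 hk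
  have hpi : (2 * Real.pi : ℂ) ≠ 0 := by simp [Real.pi_ne_zero]
  set S : ℂ := 2 * k with hS
  have hSre : S.re = 2 * k := by simp [hS]
  have hS1 : S ≠ 1 := fun h => by
    have := congrArg re h
    rw [hSre, one_re] at this
    linarith
  have h1S1 : 1 - S ≠ 1 := fun h => by
    have := congrArg re h
    rw [sub_re, hSre, one_re] at this
    linarith
  have hfe : (fun s => riemannZeta (1 - s)) =ᶠ[𝓝 S] fun s =>
      2 * (2 * Real.pi : ℂ) ^ (-s) * Gamma s * Complex.cos (Real.pi * s / 2) * riemannZeta s := by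
    filter_upwards [(isOpen_lt continuous_const continuous_re).mem_nhds
      (show (1 : ℝ) < S.re by rw [hSre]; linarith)] with s h
    have h : 1 < s.re := h
    refine riemannZeta_one_sub (fun n hn => ?_) fun hn => ?_
    · have : (0 : ℝ) ≤ n := n.cast_nonneg
      rw [hn] at h
      simp at h
      linarith
    · rw [hn] at h
      simp at h
  have hcos : Complex.cos (Real.pi * S / 2) = (-1) ^ k := by
    rw [show (Real.pi * S / 2 : ℂ) = ((k * Real.pi : ℝ) : ℂ) by rw [hS]; push_cast; ring,
      ← ofReal_cos, Real.cos_nat_mul_pi]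
    push_cast
    rfl
  have hsin : Complex.sin (Real.pi * S / 2) = 0 := by
    rw [show (Real.pi * S / 2 : ℂ) = ((k * Real.pi : ℝ) : ℂ) by rw [hS]; push_cast; ring,
      ← ofReal_sin, Real.sin_nat_mul_pi, ofReal_zero]
  have hL : HasDerivAt (fun s => riemannZeta (1 - s)) (-deriv riemannZeta (1 - S)) S := by
    have h1 : HasDerivAt (fun s : ℂ => 1 - s) (-1) S := (hasDerivAt_id S).const_sub 1
    exact ((differentiableAt_riemannZeta h1S1).hasDerivAt.comp S h1).congr_deriv (by ring)
  have hpow : HasDerivAt (fun s : ℂ => (2 * Real.pi : ℂ) ^ (-s))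
      (-((2 * Real.pi : ℂ) ^ (-S) * Real.log (2 * Real.pi))) S := by
    have := (hasDerivAt_neg S).const_cpow (c := (2 * Real.pi : ℂ)) (Or.inl hpi)
    refine this.congr_deriv ?_
    rw [ofReal_log (by positivity)]
    push_cast
    ring
  have hΓ : HasDerivAt Gamma (m.factorial * (-Real.eulerMascheroniConstant + harmonic m)) S := by
    rw [hs]; exact hasDerivAt_Gamma_nat m
  have hc : HasDerivAt (fun s : ℂ => Complex.cos (Real.pi * s / 2)) 0 S := by
    have := ((hasDerivAt_id S).const_mul (Real.pi : ℂ)).div_const 2 |>.ccos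
    refine this.congr_deriv ?_
    simp only [id]
    rw [hsin]
    simp
  have hR := (((hpow.const_mul 2).mul hΓ).mul hc).mul (differentiableAt_riemannZeta hS1).hasDerivAt
  have key := (hL.congr_of_eventuallyEq hfe.symm).unique hR
  have hval := hfe.self_of_nhds
  have hΓv : Gamma S = m.factorial := by rw [hs, Gamma_nat_eq_factorial]
  have hpv : (2 * Real.pi : ℂ) ^ (-S) = ((2 * Real.pi : ℂ) ^ (2 * k))⁻¹ := by
    rw [cpow_neg, hS, ← cpow_natCast]
    push_cast
    rfl
  simp only [Pi.mul_apply] at key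
  beta_reduce at hval
  rw [hval, hm']
  rw [hcos, hΓv, hpv] at key ⊢
  field_simp at key ⊢
  linear_combination (-1) * key

lemma lambertResidue_odd {k : ℕ} (hk : k ≠ 0) : lambertResidue (2 * k - 1) = lambertLogCoeff k := by
  have hcast : (-((2 * k - 1 : ℕ) : ℂ)) = 1 - 2 * k := by
    rw [Nat.cast_sub (by omega)]
    push_cast
    ring
  have hk0 : (k : ℂ) ≠ 0 := Nat.cast_ne_zero.2 hk
  have hζ : riemannZeta (1 - 2 * k) = -bernoulli (2 * k) / (2 * k) := by
    have h := riemannZeta_neg_nat_eq_bernoulli' (2 * k - 1)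
    rw [hcast, Nat.sub_add_cancel (by omega), ← bernoulli_eq_bernoulli'_of_ne_one (by omega)] at h
    rw [h, Nat.cast_sub (by omega)]
    push_cast
    ring
  have hfac : ((2 * k).factorial : ℂ) = 2 * k * ((2 * k - 1).factorial : ℂ) := by
    rw [← Nat.mul_factorial_pred (by omega : 2 * k ≠ 0)]
    push_cast
    rfl
  have hfac0 : ((2 * k - 1).factorial : ℂ) ≠ 0 := Nat.cast_ne_zero.2 (Nat.factorial_ne_zero _)
  have hharm : ((harmonic (2 * k - 1) : ℚ) : ℂ) = ∑ j ∈ Finset.Icc 1 (2 * k - 1), 1 / (j : ℂ) := by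
    rw [harmonic_eq_sum_Icc]
    push_cast
    simp
  have hodd : (-1 : ℂ) ^ (2 * k - 1) = -1 :=
    Odd.neg_one_pow ⟨k - 1, by omega⟩
  rw [lambertResidue, lambertLogCoeff, hcast, deriv_riemannZeta_one_sub_two_mul hk, hζ, hodd,
    hfac, ← hharm]
  have hpi : (Real.pi : ℂ) ≠ 0 := ofReal_ne_zero.2 Real.pi_ne_zero
  field_simp
  ring

lemma sum_range_lambertResidue {N : ℕ} (hN : 1 ≤ N) (y : ℂ) :
    ∑ j ∈ Finset.range (2 * N + 1), lambertResidue j * y ^ j =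
      -(1 / 4 * (Real.log (2 * Real.pi) : ℂ)) +
        y / 12 * ((Real.log glaisherKinkelin : ℂ) - 1 / 12) +
        ∑ k ∈ Finset.Icc 2 N, lambertLogCoeff k * y ^ (2 * k - 1) := by
  induction N, hN using Nat.le_induction with
  | base =>
    rw [Finset.sum_range_succ, Finset.sum_range_succ, Finset.sum_range_one, lambertResidue_zero,
      lambertResidue_one, lambertResidue_even one_ne_zero]
    simp
    ring
  | succ N hN ih =>
    rw [show 2 * (N + 1) + 1 = 2 * N + 1 + 1 + 1 by ring, Finset.sum_range_succ,
      Finset.sum_range_succ, ih, Finset.sum_Icc_succ_top (by omega),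
      show 2 * N + 1 + 1 = 2 * (N + 1) by ring, lambertResidue_even N.succ_ne_zero,
      ← lambertResidue_odd N.succ_ne_zero, show 2 * (N + 1) - 1 = 2 * N + 1 by omega]
    ring

end Residues

/-! ### The asymptotic expansion -/

section Expansion

open Complex Set

lemma re_pos_of_mem_puncturedSector {θ : ℝ} (hθ : θ < Real.pi / 2) {y : ℂ}
    (hy : y ∈ puncturedSector θ) : 0 < y.re :=
  (abs_arg_lt_pi_div_two_iff.1 (hy.2.trans_lt hθ)).resolve_right hy.1

/-- The remainder after the term in `y^{2N-1}` is the next term plus an integral on a line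
further to the left. -/
lemma lambertLog_sub_lambertLogPartial {N : ℕ} (hN : 1 ≤ N) {y : ℂ} (hy : 0 < y.re) :
    lambertLog y - lambertLogPartial N y = lambertResidue (2 * N + 1) * y ^ (2 * N + 1) +
      mellinLine lambertMellin (1 / 2 - (2 * N + 2 : ℕ)) y := by
  rw [lambertLog, (hasSum_lambertLogTerm hy).tsum_eq, mellinLine_three_eq hy,
    mellinLine_half_eq_sum (2 * N + 2) hy, Finset.sum_range_succ, sum_range_lambertResidue hN,
    lambertLogPartial]
  ring

theorem isBigO_lambertLog_sub {θ : ℝ} (hθ : θ < Real.pi / 2) {N : ℕ} (hN : 1 ≤ N) :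
    (fun y : ℂ => lambertLog y - lambertLogPartial N y)
      =O[𝓝[puncturedSector θ] (0 : ℂ)] (fun y : ℂ => y ^ (2 * N + 1)) := by
  obtain ⟨κ, hκ, hκθ⟩ := exists_decay_exponent hθ
  obtain ⟨C, hC⟩ := (verticalExpBound_lambertMellin hκ).exists_norm_mellinLine_le
    (continuous_lambertMellin_half_sub (2 * N + 2)) hκθ
  -- The integral on the line `re s = 1/2 - (2N + 2)` is `O(|y|^{2N + 3/2})`.
  refine IsBigO.of_bound (‖lambertResidue (2 * N + 1)‖ + |C|) ?_
  have hball : ∀ᶠ y : ℂ in 𝓝[puncturedSector θ] 0, ‖y‖ < 1 := by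
    refine nhdsWithin_le_nhds ?_
    exact continuous_norm.continuousAt.eventually_lt_const (by simp)
  filter_upwards [self_mem_nhdsWithin, hball] with y hy hy1
  rw [lambertLog_sub_lambertLogPartial hN (re_pos_of_mem_puncturedSector hθ hy), add_mul, norm_pow]
  refine (norm_add_le _ _).trans (add_le_add (by rw [norm_mul, norm_pow]) ?_)
  refine (hC y hy.1 hy.2).trans ?_
  have hpos : 0 < ‖y‖ := norm_pos_iff.2 hy.1
  gcongr ?_ * ?_
  · exact le_abs_self C
  · rw [← Real.rpow_natCast]
    exact Real.rpow_le_rpow_of_exponent_ge hpos hy1.le (by push_cast; linarith)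

end Expansion

theorem theorem1p2 :
    Tendsto glaisherSeq atTop (𝓝 (Real.log glaisherKinkelin)) ∧
    (∀ y : ℂ, 0 < y.re → Summable (fun n : ℕ => lambertLogTerm y (n + 1))) ∧
    ∀ θ : ℝ, θ < Real.pi / 2 → ∀ N : ℕ, 1 ≤ N →
      (fun y : ℂ => lambertLog y - lambertLogPartial N y)
        =O[𝓝[puncturedSector θ] (0 : ℂ)] (fun y : ℂ => y ^ (2 * N + 1)) :=
  ⟨ofReal_log_glaisherKinkelin.2, fun _ hy => (hasSum_lambertLogTerm hy).summable,
    fun _ hθ _ hN => isBigO_lambertLog_sub hθ hN⟩
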